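/- Let $d\in\mathbb N$, $0<T<\infty$, $\mathbb T^d=\mathbb R^d/\mathbb Z^d$ (functions on $\mathbb T^d$ are identified with $\mathbb Z^d$-periodic functions on $\mathbb R^d$), $Q_T=(0,T]\times\mathbb T^d$ and $\overline{Q_T}=[0,T]\times\mathbb T^d$. Let $H:\overline{Q_T}\times\mathbb R\times\mathbb R^d\to\mathbb R$ and $u_0:\mathbb T^d\to\mathbb R$ satisfy (A1) $H$ is continuous; (A2) there is a modulus $\omega:[0,\infty)\to[0,\infty)$ (nondecreasing, $\omega(0)=0$, $\omega(s)\to0$ as $s\searrow0$) with $|H(t,x,r,p)-H(t,y,r,p)|\le\omega(|x-y|(1+|p|))$ for all $t\in[0,T]$, $x,y\in\mathbb R^d$, $r\in\mathbb R$, $p\in\mathbb R^d$; (A3) $r\mapsto H(t,x,r,p)$ is nondecreasing for all $(t,x,p)$; (A4) $u_0$ is continuous. For $\alpha\in(0,1]$ consider the initial value problem $$\partial_t^\alpha u+H(t,x,u,Du)=0\ \text{ in } Q_T,\qquad u|_{t=0}=u_0\ \text{ on }\mathbb T^d, \qquad (P_\alpha)$$ where $\partial_t^\alpha$ is Caputo's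 time-fractional derivative for $\alpha<1$ and $\partial_t^1=\partial_t$. Solutions are viscosity solutions in the following sense. For $\alpha\in(0,1)$ put $$J_r^\alpha[f](t,x)=\frac{\alpha}{\Gamma(1-\alpha)}\int_0^r\frac{f(t,x)-f(t-\tau,x)}{\tau^{\alpha+1}}\,d\tau,\qquad K_r^\alpha[f](t,x)=\frac{f(t,x)-f(0,x)}{t^\alpha\,\Gamma(1-\alpha)}+\frac{\alpha}{\Gamma(1-\alpha)}\int_r^t\frac{f(t,x)-f(t-\tau,x)}{\tau^{\alpha+1}}\,d\tau,$$ and let $\mathcal C^1$ be the set of $\phi\in C^1((0,T]\times\mathbb R^d)\cap C([0,T]\times\mathbb R^d)$ with $\partial_t\phi(\cdot,x)\in L^1(0,T)$ for every $x\in\mathbb{R}^d$. An upper (resp. lower) semicontinuous $u:\overline{Q_T}\to\mathbb R$ is a subsolution (resp. supersolution) of the equation of order $\alpha\in(0,1)$ if, for all $0\le a<b\le T$, every open ball $B\subset\mathbb R^d$ and every $\phi\in\mathcal C^1$, whenever $u-\phi$ attains a maximum (resp. minimum) over $[a,b]\times\overline B$ at a point $(\hat t,\hat x)\in(a,b]\times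 B$, one has $$J^\alpha_{\hat t-a}[\phi](\hat t,\hat x)+K^\alpha_{\hat t-a}[u](\hat t,\hat x)+H(\hat t,\hat x,u(\hat t,\hat x),D\phi(\hat t,\hat x))\le0\quad(\text{resp. }\ge0).$$ For $\alpha=1$ sub- and supersolutions are the usual ones: $\partial_t\phi(\hat t,\hat x)+H(\hat t,\hat x,u(\hat t,\hat x),D\phi(\hat t,\hat x))\le0$ (resp. $\ge0$) whenever $\phi\in C^1((0,T]\times\mathbb R^d)$ and $u-\phi$ has a local maximum (resp. minimum) relative to $(0,T]\times\mathbb R^d$ at $(\hat t,\hat x)\in (0,T]\times\mathbb R^d$. A solution of $(P_\alpha)$ is a function $u\in C(\overline{Q_T})$ that is both a subsolution and a supersolution and satisfies $u(0,\cdot)=u_0$. **Theorem (Stability II).** For each $\alpha\in(0,1)$ let $u_\alpha\in C(\overline{Q_T})$ be a solution of $(P_\alpha)$, and let $\beta\in(0,1]$. Then $(P_\beta)$ has a solution, and for every solution $u_\beta$ of $(P_\beta)$ the functions $u_\alpha$ converge to $u_\beta$ locally uniformly in $Q_T$ as $\alpha\to\beta$, $\alpha\in(0,1)$. -/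

import Mathlib

open Set Filter Topology MeasureTheory

namespace FracHJ

/-- The space `ℝ^d` with its Euclidean norm. -/
abbrev Space (d : ℕ) : Type := EuclideanSpace ℝ (Fin d)

/-- The vector of `ℝ^d` with integer coordinates `z`. -/
def latticeVec {d : ℕ} (z : Fin d → ℤ) : Space d :=
  WithLp.toLp 2 (fun i => (z i : ℝ))

/-- `ℤ^d`-periodicity. A function on the torus `ℝ^d / ℤ^d` is regarded throughout as a
`ℤ^d`-periodic function on `ℝ^d`. -/
def LatticePeriodic {d : ℕ} (f : Space d → ℝ) : Prop :=
  ∀ (x : Space d) (z : Fin d → ℤ), f (x + latticeVec z) = f x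

/-- The set `(0,T] × ℝ^d`. -/
def QT (d : ℕ) (T : ℝ) : Set (ℝ × Space d) := Ioc 0 T ×ˢ univ

/-- The set `[0,T] × ℝ^d`. -/
def QTbar (d : ℕ) (T : ℝ) : Set (ℝ × Space d) := Icc 0 T ×ˢ univ

/-- A modulus (of continuity): a nonnegative nondecreasing function on `[0,∞)` that vanishes at `0`
and tends to `0` at `0`. -/
def IsModulus (ω : ℝ → ℝ) : Prop :=
  (∀ s, 0 ≤ s → 0 ≤ ω s) ∧ MonotoneOn ω (Ici 0) ∧ ω 0 = 0 ∧ Tendsto ω (𝓝[≥] 0) (𝓝 0)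

/-- The test functions for orders less than one: functions that are continuous on `[0,T] × ℝ^d`,
`C¹` on `(0,T] × ℝ^d` (one-sided at `t = T`), and whose time derivative at each fixed `x` is Lebesgue
integrable on `(0,T)`. No periodicity is required. -/
def IsTestFunction {d : ℕ} (T : ℝ) (φ : ℝ × Space d → ℝ) : Prop :=
  ContDiffOn ℝ 1 φ (QT d T) ∧ ContinuousOn φ (QTbar d T) ∧
    ∀ x : Space d, IntegrableOn (fun t => deriv (fun s => φ (s, x)) t) (Ioo 0 T)

/-- The time derivative on `(0,T]`, one-sided at `t = T`. -/
noncomputable def timeDeriv {d : ℕ} (T : ℝ) (φ : ℝ × Space d → ℝ) (t : ℝ) (x : Space d) : ℝ :=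
  derivWithin (fun s => φ (s, x)) (Ioc 0 T) t

/-- The spatial gradient. -/
noncomputable def spaceGrad {d : ℕ} (φ : ℝ × Space d → ℝ) (t : ℝ) (x : Space d) : Space d :=
  gradient (fun y => φ (t, y)) x

/-- The integrand `(f(t,x) - f(t-τ,x)) / τ^(α+1)`. -/
noncomputable def kernelDiff {d : ℕ} (α : ℝ) (f : ℝ × Space d → ℝ) (t : ℝ) (x : Space d) (τ : ℝ) :
    ℝ :=
  (f (t, x) - f (t - τ, x)) / τ ^ (α + 1)

/-- `J_r[f](t,x) = α/Γ(1-α) ∫_0^r (f(t,x) - f(t-τ,x)) dτ/τ^(α+1)`. -/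
noncomputable def J {d : ℕ} (α r : ℝ) (f : ℝ × Space d → ℝ) (t : ℝ) (x : Space d) : ℝ :=
  α / Real.Gamma (1 - α) * ∫ τ in (0 : ℝ)..r, kernelDiff α f t x τ

/-- `K_r[f](t,x) = (f(t,x) - f(0,x))/(t^α Γ(1-α)) + α/Γ(1-α) ∫_r^t (f(t,x) - f(t-τ,x)) dτ/τ^(α+1)`. -/
noncomputable def K {d : ℕ} (α r : ℝ) (f : ℝ × Space d → ℝ) (t : ℝ) (x : Space d) : ℝ :=
  (f (t, x) - f (0, x)) / (t ^ α * Real.Gamma (1 - α)) +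
    α / Real.Gamma (1 - α) * ∫ τ in r..t, kernelDiff α f t x τ

/-- Viscosity subsolution of `∂_t^α u + H(t,x,u,Du) = 0` in `(0,T] × 𝕋^d` for `0 < α < 1`.
For an upper semicontinuous `u` the integral in `K_r[u]`, `r > 0`, is well defined in `(-∞,+∞]`;
the inequality `≤ 0` contains that it is finite, which is the integrability recorded here
(it is automatic when `u` is continuous). -/
def IsFracSubsolution {d : ℕ} (T α : ℝ) (H : ℝ → Space d → ℝ → Space d → ℝ)
    (u : ℝ × Space d → ℝ) : Prop :=
  UpperSemicontinuousOn u (QTbar d T) ∧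
  (∀ t ∈ Icc 0 T, LatticePeriodic fun x => u (t, x)) ∧
  ∀ (a b : ℝ) (c : Space d) (ρ : ℝ) (φ : ℝ × Space d → ℝ) (t : ℝ) (x : Space d),
    a ∈ Icc 0 T → b ∈ Icc 0 T → a < b → 0 < ρ → IsTestFunction T φ →
    t ∈ Ioc a b → x ∈ Metric.ball c ρ →
    IsMaxOn (fun p => u p - φ p) (Icc a b ×ˢ Metric.closedBall c ρ) (t, x) →
    IntervalIntegrable (kernelDiff α u t x) volume (t - a) t ∧
    J α (t - a) φ t x + K α (t - a) u t x + H t x (u (t, x)) (spaceGrad φ t x) ≤ 0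

/-- Viscosity supersolution of `∂_t^α u + H(t,x,u,Du) = 0` in `(0,T] × 𝕋^d` for `0 < α < 1`. -/
def IsFracSupersolution {d : ℕ} (T α : ℝ) (H : ℝ → Space d → ℝ → Space d → ℝ)
    (u : ℝ × Space d → ℝ) : Prop :=
  LowerSemicontinuousOn u (QTbar d T) ∧
  (∀ t ∈ Icc 0 T, LatticePeriodic fun x => u (t, x)) ∧
  ∀ (a b : ℝ) (c : Space d) (ρ : ℝ) (φ : ℝ × Space d → ℝ) (t : ℝ) (x : Space d),
    a ∈ Icc 0 T → b ∈ Icc 0 T → a < b → 0 < ρ → IsTestFunction T φ →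
    t ∈ Ioc a b → x ∈ Metric.ball c ρ →
    IsMinOn (fun p => u p - φ p) (Icc a b ×ˢ Metric.closedBall c ρ) (t, x) →
    IntervalIntegrable (kernelDiff α u t x) volume (t - a) t ∧
    0 ≤ J α (t - a) φ t x + K α (t - a) u t x + H t x (u (t, x)) (spaceGrad φ t x)

/-- Viscosity subsolution of the first-order equation `∂_t u + H(t,x,u,Du) = 0` in `(0,T] × 𝕋^d`,
in the usual (Crandall-Lions) sense. -/
def IsFirstOrderSubsolution {d : ℕ} (T : ℝ) (H : ℝ → Space d → ℝ → Space d → ℝ)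
    (u : ℝ × Space d → ℝ) : Prop :=
  UpperSemicontinuousOn u (QTbar d T) ∧
  (∀ t ∈ Icc 0 T, LatticePeriodic fun x => u (t, x)) ∧
  ∀ (φ : ℝ × Space d → ℝ) (t : ℝ) (x : Space d),
    ContDiffOn ℝ 1 φ (QT d T) → t ∈ Ioc 0 T →
    IsLocalMaxOn (fun p => u p - φ p) (QT d T) (t, x) →
    timeDeriv T φ t x + H t x (u (t, x)) (spaceGrad φ t x) ≤ 0

/-- Viscosity supersolution of the first-order equation `∂_t u + H(t,x,u,Du) = 0` in
`(0,T] × 𝕋^d`, in the usual (Crandall-Lions) sense. -/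
def IsFirstOrderSupersolution {d : ℕ} (T : ℝ) (H : ℝ → Space d → ℝ → Space d → ℝ)
    (u : ℝ × Space d → ℝ) : Prop :=
  LowerSemicontinuousOn u (QTbar d T) ∧
  (∀ t ∈ Icc 0 T, LatticePeriodic fun x => u (t, x)) ∧
  ∀ (φ : ℝ × Space d → ℝ) (t : ℝ) (x : Space d),
    ContDiffOn ℝ 1 φ (QT d T) → t ∈ Ioc 0 T →
    IsLocalMinOn (fun p => u p - φ p) (QT d T) (t, x) →
    0 ≤ timeDeriv T φ t x + H t x (u (t, x)) (spaceGrad φ t x)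

/-- Viscosity subsolution of the equation of order `α ∈ (0,1]`. -/
def IsSubsolution {d : ℕ} (T α : ℝ) (H : ℝ → Space d → ℝ → Space d → ℝ)
    (u : ℝ × Space d → ℝ) : Prop :=
  (α ≠ 1 → IsFracSubsolution T α H u) ∧ (α = 1 → IsFirstOrderSubsolution T H u)

/-- Viscosity supersolution of the equation of order `α ∈ (0,1]`. -/
def IsSupersolution {d : ℕ} (T α : ℝ) (H : ℝ → Space d → ℝ → Space d → ℝ)
    (u : ℝ × Space d → ℝ) : Prop :=
  (α ≠ 1 → IsFracSupersolution T α H u) ∧ (α = 1 → IsFirstOrderSupersolution T H u)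

/-- Viscosity solution of the initial value problem
`∂_t^α u + H(t,x,u,Du) = 0` in `(0,T] × 𝕋^d`, `u(0,·) = u₀`, of order `α ∈ (0,1]`:
a function that is continuous on `[0,T] × 𝕋^d`, both a sub- and a supersolution,
and equal to `u₀` at time `0`. -/
def IsSolution {d : ℕ} (T α : ℝ) (H : ℝ → Space d → ℝ → Space d → ℝ) (u₀ : Space d → ℝ)
    (u : ℝ × Space d → ℝ) : Prop :=
  ContinuousOn u (QTbar d T) ∧ IsSubsolution T α H u ∧ IsSupersolution T α H u ∧
    ∀ x, u (0, x) = u₀ x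

end FracHJ

namespace FracHJ

variable {d : ℕ} {T : ℝ}

/-- The structural hypotheses on the Hamiltonian. -/
structure IsHamiltonian (T : ℝ) (H : ℝ → Space d → ℝ → Space d → ℝ) : Prop where
  periodic : ∀ t ∈ Icc 0 T, ∀ (r : ℝ) (p : Space d), LatticePeriodic fun x => H t x r p
  continuousOn : ContinuousOn
    (fun q : ℝ × Space d × ℝ × Space d => H q.1 q.2.1 q.2.2.1 q.2.2.2) (Icc 0 T ×ˢ univ)
  modulus : ∃ ω : ℝ → ℝ, IsModulus ω ∧ ∀ t ∈ Icc 0 T, ∀ (x y : Space d) (r : ℝ) (p : Space d),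
    |H t x r p - H t y r p| ≤ ω (‖x - y‖ * (1 + ‖p‖))
  mono : ∀ t ∈ Icc 0 T, ∀ (x p : Space d), Monotone fun r => H t x r p

/-- The Hamiltonian of the equation satisfied by `-u`. -/
def negHam (H : ℝ → Space d → ℝ → Space d → ℝ) : ℝ → Space d → ℝ → Space d → ℝ :=
  fun t x r p => -H t x (-r) (-p)

lemma negHam_negHam (H : ℝ → Space d → ℝ → Space d → ℝ) : negHam (negHam H) = H := by
  funext t x r p; simp [negHam]

lemma IsHamiltonian.neg {H : ℝ → Space d → ℝ → Space d → ℝ} (hH : IsHamiltonian T H) :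
    IsHamiltonian T (negHam H) where
  periodic t ht r p x z := by
    exact congrArg Neg.neg (hH.periodic t ht (-r) (-p) x z)
  continuousOn := by
    have h := hH.continuousOn
    have hg : ContinuousOn (fun q : ℝ × Space d × ℝ × Space d =>
        ((q.1, q.2.1, -q.2.2.1, -q.2.2.2) : ℝ × Space d × ℝ × Space d)) (Icc 0 T ×ˢ univ) := by
      fun_prop
    have := (h.comp hg (fun q hq => ⟨hq.1, mem_univ _⟩)).neg
    exact this
  modulus := by
    obtain ⟨ω, hω, h⟩ := hH.modulus
    refine ⟨ω, hω, fun t ht x y r p => ?_⟩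
    have := h t ht x y (-r) (-p)
    rw [norm_neg] at this
    simp only [negHam]
    rwa [neg_sub_neg, abs_sub_comm]
  mono t ht x p r s hrs := by
    simp only [negHam]
    exact neg_le_neg (hH.mono t ht x (-p) (neg_le_neg hrs))

lemma LatticePeriodic.neg {f : Space d → ℝ} (h : LatticePeriodic f) :
    LatticePeriodic fun x => -f x := fun x z => by simp only [h x z]

lemma kernelDiff_neg (α : ℝ) (f : ℝ × Space d → ℝ) (t : ℝ) (x : Space d) :
    kernelDiff α (fun p => -f p) t x = fun τ => -kernelDiff α f t x τ := by
  funext τ; simp only [kernelDiff]; ring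

lemma J_neg (α r : ℝ) (f : ℝ × Space d → ℝ) (t : ℝ) (x : Space d) :
    J α r (fun p => -f p) t x = -J α r f t x := by
  simp only [J, kernelDiff_neg, intervalIntegral.integral_neg]; ring

lemma K_neg (α r : ℝ) (f : ℝ × Space d → ℝ) (t : ℝ) (x : Space d) :
    K α r (fun p => -f p) t x = -K α r f t x := by
  simp only [K, kernelDiff_neg, intervalIntegral.integral_neg]; ring

lemma spaceGrad_neg (φ : ℝ × Space d → ℝ) (t : ℝ) (x : Space d) :
    spaceGrad (fun p => -φ p) t x = -spaceGrad φ t x := by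
  simp only [spaceGrad, gradient, fderiv_fun_neg, map_neg]

lemma timeDeriv_neg (φ : ℝ × Space d → ℝ) (t : ℝ) (x : Space d) :
    timeDeriv T (fun p => -φ p) t x = -timeDeriv T φ t x := by
  simp only [timeDeriv]
  exact derivWithin.fun_neg

lemma IsTestFunction.neg {φ : ℝ × Space d → ℝ} (h : IsTestFunction T φ) :
    IsTestFunction T fun p => -φ p := by
  refine ⟨h.1.neg, h.2.1.neg, fun x => ?_⟩
  have : (fun t => deriv (fun s => -φ (s, x)) t) = fun t => -deriv (fun s => φ (s, x)) t := by
    funext t; exact deriv.fun_neg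
  rw [this]
  exact (h.2.2 x).neg

lemma IsFracSupersolution.neg {α : ℝ} {H : ℝ → Space d → ℝ → Space d → ℝ}
    {u : ℝ × Space d → ℝ} (h : IsFracSupersolution T α H u) :
    IsFracSubsolution T α (negHam H) fun p => -u p := by
  refine ⟨?_, fun t ht => (h.2.1 t ht).neg, ?_⟩
  · intro p hp c hc
    filter_upwards [h.1 p hp (-c) (by linarith)] with q hq
    linarith
  · intro a b c ρ φ t x ha hb hab hρ hφ ht hx hmax
    obtain ⟨h1, h2⟩ := h.2.2 a b c ρ (fun p => -φ p) t x ha hb hab hρ hφ.neg ht hx (by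
      intro p hp
      have := hmax hp
      simp only [mem_ofPred_eq] at this ⊢
      linarith)
    refine ⟨by rw [kernelDiff_neg]; exact h1.neg, ?_⟩
    rw [J_neg, spaceGrad_neg] at h2
    rw [K_neg]
    simp only [negHam, neg_neg]
    linarith

lemma IsFirstOrderSupersolution.neg {H : ℝ → Space d → ℝ → Space d → ℝ}
    {u : ℝ × Space d → ℝ} (h : IsFirstOrderSupersolution T H u) :
    IsFirstOrderSubsolution T (negHam H) fun p => -u p := by
  refine ⟨?_, fun t ht => (h.2.1 t ht).neg, ?_⟩
  · intro p hp c hc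
    filter_upwards [h.1 p hp (-c) (by linarith)] with q hq
    linarith
  · intro φ t x hφ ht hmax
    have h2 := h.2.2 (fun p => -φ p) t x hφ.neg ht (by
      filter_upwards [hmax] with p hp
      linarith)
    rw [timeDeriv_neg, spaceGrad_neg] at h2
    simp only [negHam, neg_neg]
    linarith

lemma IsFirstOrderSubsolution.neg {H : ℝ → Space d → ℝ → Space d → ℝ}
    {u : ℝ × Space d → ℝ} (h : IsFirstOrderSubsolution T H u) :
    IsFirstOrderSupersolution T (negHam H) fun p => -u p := by
  refine ⟨?_, fun t ht => (h.2.1 t ht).neg, ?_⟩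
  · intro p hp c hc
    filter_upwards [h.1 p hp (-c) (by linarith)] with q hq
    linarith
  · intro φ t x hφ ht hmax
    have h2 := h.2.2 (fun p => -φ p) t x hφ.neg ht (by
      filter_upwards [hmax] with p hp
      linarith)
    rw [timeDeriv_neg, spaceGrad_neg] at h2
    simp only [negHam, neg_neg]
    linarith

lemma uniqueDiffOn_QT : UniqueDiffOn ℝ (QT d T) :=
  (uniqueDiffOn_Ioc 0 T).prod uniqueDiffOn_univ

lemma QT_subset_QTbar : QT d T ⊆ QTbar d T := fun _ hp => ⟨Ioc_subset_Icc_self hp.1, hp.2⟩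

section Derivatives

variable {φ : ℝ × Space d → ℝ} (hφ : ContDiffOn ℝ 1 φ (QT d T))
include hφ

lemma hasFDerivWithinAt_QT {t : ℝ} (ht : t ∈ Ioc 0 T) (x : Space d) :
    HasFDerivWithinAt φ (fderivWithin ℝ φ (QT d T) (t, x)) (QT d T) (t, x) :=
  ((hφ.differentiableOn one_ne_zero) (t, x) ⟨ht, mem_univ _⟩).hasFDerivWithinAt

lemma hasDerivWithinAt_time {t : ℝ} (ht : t ∈ Ioc 0 T) (x : Space d) :
    HasDerivWithinAt (fun s => φ (s, x)) (timeDeriv T φ t x) (Ioc 0 T) t := by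
  have h1 : HasDerivWithinAt (fun s : ℝ => ((s, x) : ℝ × Space d)) ((1 : ℝ), (0 : Space d))
      (Ioc 0 T) t := (hasDerivWithinAt_id t _).prodMk (hasDerivWithinAt_const t _ x)
  have := (hasFDerivWithinAt_QT hφ ht x).comp_hasDerivWithinAt t h1
    (fun s hs => show (s, x) ∈ QT d T from ⟨hs, mem_univ _⟩)
  have h2 : HasDerivWithinAt (fun s => φ (s, x)) _ (Ioc 0 T) t := this
  exact h2.differentiableWithinAt.hasDerivWithinAt

lemma timeDeriv_eq {t : ℝ} (ht : t ∈ Ioc 0 T) (x : Space d) :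
    timeDeriv T φ t x = fderivWithin ℝ φ (QT d T) (t, x) ((1 : ℝ), (0 : Space d)) := by
  have h1 : HasDerivWithinAt (fun s : ℝ => ((s, x) : ℝ × Space d)) ((1 : ℝ), (0 : Space d))
      (Ioc 0 T) t := (hasDerivWithinAt_id t _).prodMk (hasDerivWithinAt_const t _ x)
  have := (hasFDerivWithinAt_QT hφ ht x).comp_hasDerivWithinAt t h1
    (fun s hs => show (s, x) ∈ QT d T from ⟨hs, mem_univ _⟩)
  exact this.derivWithin (uniqueDiffOn_Ioc 0 T t ht)

lemma hasFDerivAt_space {t : ℝ} (ht : t ∈ Ioc 0 T) (x : Space d) :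
    HasFDerivAt (fun y => φ (t, y))
      ((fderivWithin ℝ φ (QT d T) (t, x)).comp (ContinuousLinearMap.inr ℝ ℝ (Space d))) x := by
  have h1 : HasFDerivWithinAt (fun y : Space d => ((t, y) : ℝ × Space d))
      (ContinuousLinearMap.inr ℝ ℝ (Space d)) univ x :=
    (hasFDerivAt_prodMk_right t x).hasFDerivWithinAt
  have := (hasFDerivWithinAt_QT hφ ht x).comp x h1 (fun y _ => ⟨ht, mem_univ _⟩)
  exact hasFDerivWithinAt_univ.1 this

lemma spaceGrad_eq {t : ℝ} (ht : t ∈ Ioc 0 T) (x : Space d) :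
    spaceGrad φ t x = (InnerProductSpace.toDual ℝ (Space d)).symm
      ((fderivWithin ℝ φ (QT d T) (t, x)).comp (ContinuousLinearMap.inr ℝ ℝ (Space d))) := by
  simp only [spaceGrad, gradient, (hasFDerivAt_space hφ ht x).fderiv]

lemma continuousOn_timeDeriv : ContinuousOn (fun p => timeDeriv T φ p.1 p.2) (QT d T) := by
  have h := hφ.continuousOn_fderivWithin uniqueDiffOn_QT le_rfl
  refine (h.clm_apply (continuousOn_const (c := ((1 : ℝ), (0 : Space d))))).congr ?_
  rintro ⟨t, x⟩ hp
  exact timeDeriv_eq hφ hp.1 x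

lemma continuousOn_spaceGrad : ContinuousOn (fun p => spaceGrad φ p.1 p.2) (QT d T) := by
  have h := hφ.continuousOn_fderivWithin uniqueDiffOn_QT le_rfl
  refine ((InnerProductSpace.toDual ℝ (Space d)).symm.continuous.comp_continuousOn
    (h.clm_comp (continuousOn_const
      (c := ContinuousLinearMap.inr ℝ ℝ (Space d))))).congr ?_
  rintro ⟨t, x⟩ hp
  exact spaceGrad_eq hφ hp.1 x

lemma timeDeriv_add {ψ : ℝ × Space d → ℝ} (hψ : ContDiffOn ℝ 1 ψ (QT d T)) {t : ℝ}
    (ht : t ∈ Ioc 0 T) (x : Space d) :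
    timeDeriv T (fun p => φ p + ψ p) t x = timeDeriv T φ t x + timeDeriv T ψ t x :=
  ((hasDerivWithinAt_time hφ ht x).add (hasDerivWithinAt_time hψ ht x)).derivWithin
    (uniqueDiffOn_Ioc 0 T t ht)

lemma spaceGrad_add {ψ : ℝ × Space d → ℝ} (hψ : ContDiffOn ℝ 1 ψ (QT d T)) {t : ℝ}
    (ht : t ∈ Ioc 0 T) (x : Space d) :
    spaceGrad (fun p => φ p + ψ p) t x = spaceGrad φ t x + spaceGrad ψ t x := by
  simp only [spaceGrad, gradient]
  rw [fderiv_fun_add (hasFDerivAt_space hφ ht x).differentiableAt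
    (hasFDerivAt_space hψ ht x).differentiableAt, map_add]

lemma deriv_eq_timeDeriv {t : ℝ} (ht : t ∈ Ioo 0 T) (x : Space d) :
    deriv (fun s => φ (s, x)) t = timeDeriv T φ t x :=
  ((hasDerivWithinAt_time hφ (Ioo_subset_Ioc_self ht) x).hasDerivAt
    (Ioc_mem_nhds ht.1 ht.2)).deriv

end Derivatives

lemma IsTestFunction.add {φ ψ : ℝ × Space d → ℝ} (h : IsTestFunction T φ)
    (h' : IsTestFunction T ψ) : IsTestFunction T fun p => φ p + ψ p := by
  refine ⟨h.1.add h'.1, h.2.1.add h'.2.1, fun x => ?_⟩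
  refine ((h.2.2 x).add (h'.2.2 x)).congr_fun (fun t ht => ?_) measurableSet_Ioo
  simp only [Pi.add_apply]
  rw [deriv_eq_timeDeriv (h.1.add h'.1) ht, deriv_eq_timeDeriv h.1 ht,
    deriv_eq_timeDeriv h'.1 ht, timeDeriv_add h.1 h'.1 (Ioo_subset_Ioc_self ht)]

lemma isTestFunction_of_contDiff {φ : ℝ × Space d → ℝ} (h : ContDiff ℝ 1 φ) :
    IsTestFunction T φ := by
  refine ⟨h.contDiffOn, h.continuous.continuousOn, fun x => ?_⟩
  have h1 : ContDiff ℝ 1 fun s : ℝ => φ (s, x) := h.comp (by fun_prop)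
  exact ((h1.continuous_deriv le_rfl).integrableOn_Icc (a := 0) (b := T)).mono_set Ioo_subset_Icc_self

/-- A `C¹` function on `(0,T] × ℝ^d` that vanishes near `t = 0` is a test function. -/
lemma isTestFunction_of_eq_zero {φ : ℝ × Space d → ℝ} (h : ContDiffOn ℝ 1 φ (QT d T)) {c : ℝ}
    (hc : 0 < c) (h0 : ∀ t < c, ∀ x, φ (t, x) = 0) : IsTestFunction T φ := by
  refine ⟨h, ?_, fun x => ?_⟩
  · rintro ⟨t, x⟩ hp
    rcases lt_or_ge t c with htc | htc
    · have : φ =ᶠ[𝓝 (t, x)] fun _ => 0 := by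
        have : ∀ᶠ p : ℝ × Space d in 𝓝 (t, x), p.1 < c :=
          continuous_fst.continuousAt.eventually (Iio_mem_nhds htc)
        filter_upwards [this] with p hp
        exact h0 p.1 hp p.2
      exact (continuousAt_const.congr this.symm).continuousWithinAt
    · have hp' : (t, x) ∈ QT d T := ⟨⟨hc.trans_le htc, hp.1.2⟩, mem_univ _⟩
      refine (h.continuousOn (t, x) hp').mono_of_mem_nhdsWithin ?_
      have : ∀ᶠ p : ℝ × Space d in 𝓝 (t, x), 0 < p.1 :=
        continuous_fst.continuousAt.eventually (Ioi_mem_nhds (hc.trans_le htc))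
      filter_upwards [mem_nhdsWithin_of_mem_nhds this, self_mem_nhdsWithin] with p hp1 hp2
      exact ⟨⟨hp1, hp2.1.2⟩, mem_univ _⟩
  · have hcont : ContinuousOn (fun s => timeDeriv T φ s x) (Icc (c / 2) T) :=
      (continuousOn_timeDeriv h).comp (f := fun s : ℝ => ((s, x) : ℝ × Space d)) (by fun_prop)
        (fun s hs => ⟨⟨(half_pos hc).trans_le hs.1, hs.2⟩, mem_univ _⟩)
    have h1 : IntegrableOn (fun t => deriv (fun s => φ (s, x)) t) (Ioo 0 T ∩ Ici (c / 2)) := by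
      refine (hcont.integrableOn_Icc.mono_set (s := Ioo 0 T ∩ Ici (c / 2))
        (fun s hs => ⟨hs.2, hs.1.2.le⟩)).congr_fun (fun t ht => ?_)
        (measurableSet_Ioo.inter measurableSet_Ici)
      exact (deriv_eq_timeDeriv h ht.1 x).symm
    have h2 : IntegrableOn (fun t => deriv (fun s => φ (s, x)) t) (Ioo 0 T ∩ Iio (c / 2)) := by
      refine (integrableOn_zero (s := Ioo 0 T ∩ Iio (c / 2))).congr_fun (fun t ht => ?_)
        (measurableSet_Ioo.inter measurableSet_Iio)
      have : (fun s => φ (s, x)) =ᶠ[𝓝 t] fun _ => 0 := by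
        filter_upwards [Iio_mem_nhds (show t < c by have := ht.2; simp at this; linarith)] with s hs
        exact h0 s hs x
      rw [this.deriv_eq]; simp
    refine (h1.union h2).mono_set fun s hs => ?_
    rcases lt_or_ge s (c / 2) with h | h
    · exact Or.inr ⟨hs, h⟩
    · exact Or.inl ⟨hs, h⟩

lemma continuous_inv_Gamma : Continuous fun s : ℝ => (Real.Gamma s)⁻¹ := by
  have h := Complex.differentiable_one_div_Gamma.continuous.comp Complex.continuous_ofReal
  have h2 := Complex.continuous_re.comp h
  refine h2.congr fun s => ?_
  simp only [Function.comp, Complex.Gamma_ofReal, ← Complex.ofReal_inv, Complex.ofReal_re]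

/-- The constant `α / Γ(2-α)`. -/
noncomputable def gcoef (α : ℝ) : ℝ := α * (Real.Gamma (2 - α))⁻¹

lemma continuous_gcoef : Continuous gcoef :=
  continuous_id.mul (continuous_inv_Gamma.comp (continuous_const.sub continuous_id))

lemma gcoef_pos {α : ℝ} (h0 : 0 < α) (h1 : α ≤ 1) : 0 < gcoef α :=
  mul_pos h0 (inv_pos.2 (Real.Gamma_pos_of_pos (by linarith)))

lemma gcoef_eq {α : ℝ} (h1 : α < 1) : gcoef α = α / Real.Gamma (1 - α) / (1 - α) := by
  have h : Real.Gamma (2 - α) = (1 - α) * Real.Gamma (1 - α) := by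
    rw [← Real.Gamma_add_one (by linarith)]; ring_nf
  have h3 := (Real.Gamma_pos_of_pos (show 0 < 1 - α by linarith)).ne'
  have h4 : 1 - α ≠ 0 := by linarith
  rw [gcoef, h]; field_simp

lemma intervalIntegrable_kernelDiff_test {φ : ℝ × Space d → ℝ} {α t r C m : ℝ} {x : Space d}
    (hα1 : α < 1) (hφ : ContinuousOn φ (QTbar d T)) (hr : 0 < r) (hrt : r ≤ t) (htT : t ≤ T)
    (hlow : ∀ τ ∈ Ioc 0 r, m * τ ≤ φ (t, x) - φ (t - τ, x))
    (hup : ∀ τ ∈ Ioc 0 r, φ (t, x) - φ (t - τ, x) ≤ C * τ) :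
    IntervalIntegrable (kernelDiff α φ t x) volume 0 r := by
  have hint : IntervalIntegrable (fun τ : ℝ => (|C| + |m|) * τ ^ (-α)) volume 0 r :=
    (intervalIntegral.intervalIntegrable_rpow' (by linarith)).const_mul _
  refine hint.mono_fun' ?_ ?_
  · rw [uIoc_of_le hr.le]
    refine ContinuousOn.aestronglyMeasurable ?_ measurableSet_Ioc
    have h1 : ContinuousOn (fun τ : ℝ => φ (t - τ, x)) (Ioc 0 r) :=
      hφ.comp (f := fun τ : ℝ => ((t - τ, x) : ℝ × Space d)) (by fun_prop)
        (fun τ hτ => ⟨⟨by linarith [hτ.2], by linarith [hτ.1]⟩, mem_univ _⟩)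
    refine (continuousOn_const.sub h1).div (fun τ hτ => ?_) (fun τ hτ => ?_)
    · exact (Real.continuousAt_rpow_const _ _ (Or.inl hτ.1.ne')).continuousWithinAt
    · exact (Real.rpow_pos_of_pos hτ.1 _).ne'
  · rw [uIoc_of_le hr.le]
    refine (ae_restrict_iff' measurableSet_Ioc).2 (Eventually.of_forall fun τ hτ => ?_)
    have hpos := Real.rpow_pos_of_pos hτ.1 (α + 1)
    change ‖(φ (t, x) - φ (t - τ, x)) / τ ^ (α + 1)‖ ≤ _
    rw [Real.norm_eq_abs, abs_div, abs_of_pos hpos, div_le_iff₀ hpos, mul_assoc,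
      ← Real.rpow_add hτ.1, show -α + (α + 1) = 1 by ring, Real.rpow_one, abs_le]
    have h1 := hlow τ hτ
    have h2 := hup τ hτ
    have h3 : -|m| * τ ≤ m * τ := mul_le_mul_of_nonneg_right (neg_abs_le m) hτ.1.le
    have h4 : C * τ ≤ |C| * τ := mul_le_mul_of_nonneg_right (le_abs_self C) hτ.1.le
    have h5 := mul_nonneg (abs_nonneg C) hτ.1.le
    have h6 := mul_nonneg (abs_nonneg m) hτ.1.le
    constructor <;> nlinarith

lemma le_J_of_bounds {φ : ℝ × Space d → ℝ} {α t r C m : ℝ} {x : Space d} (hα0 : 0 < α)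
    (hα1 : α < 1) (hφ : ContinuousOn φ (QTbar d T)) (hr : 0 < r) (hrt : r ≤ t) (htT : t ≤ T)
    (hlow : ∀ τ ∈ Ioc 0 r, m * τ ≤ φ (t, x) - φ (t - τ, x))
    (hup : ∀ τ ∈ Ioc 0 r, φ (t, x) - φ (t - τ, x) ≤ C * τ) :
    m * gcoef α * r ^ (1 - α) ≤ J α r φ t x := by
  have hint := intervalIntegrable_kernelDiff_test hα1 hφ hr hrt htT hlow hup
  have hint2 : IntervalIntegrable (fun τ : ℝ => m * τ ^ (-α)) volume 0 r :=
    (intervalIntegral.intervalIntegrable_rpow' (by linarith)).const_mul _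
  have hmono : ∫ τ in (0 : ℝ)..r, m * τ ^ (-α) ≤ ∫ τ in (0 : ℝ)..r, kernelDiff α φ t x τ := by
    refine intervalIntegral.integral_mono_on_of_le_Ioo hr.le hint2 hint fun τ hτ => ?_
    have hpos := Real.rpow_pos_of_pos hτ.1 (α + 1)
    rw [kernelDiff, le_div_iff₀ hpos, mul_assoc,
      ← Real.rpow_add hτ.1, show -α + (α + 1) = 1 by ring, Real.rpow_one]
    exact hlow τ (Ioo_subset_Ioc_self hτ)
  have hval : ∫ τ in (0 : ℝ)..r, m * τ ^ (-α) = m * (r ^ (1 - α) / (1 - α)) := by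
    rw [intervalIntegral.integral_const_mul, integral_rpow (Or.inl (by linarith)),
      show -α + 1 = 1 - α by ring, Real.zero_rpow (by linarith), sub_zero]
  have hΓ := Real.Gamma_pos_of_pos (show 0 < 1 - α by linarith)
  rw [hval] at hmono
  rw [J, gcoef_eq hα1]
  refine le_trans (le_of_eq ?_) (mul_le_mul_of_nonneg_left hmono (div_pos hα0 hΓ).le)
  ring

lemma IsFracSubsolution.K_add_le {φ u : ℝ × Space d → ℝ} {H : ℝ → Space d → ℝ → Space d → ℝ}
    {α a b ρ t r C m : ℝ} {c x : Space d} (hu : IsFracSubsolution T α H u) (hα0 : 0 < α)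
    (hα1 : α < 1) (ha : a ∈ Icc 0 T) (hb : b ∈ Icc 0 T) (hρ : 0 < ρ) (hφ : IsTestFunction T φ)
    (ht : t ∈ Ioc a b) (hx : x ∈ Metric.ball c ρ)
    (hmax : IsMaxOn (fun p => u p - φ p) (Icc a b ×ˢ Metric.closedBall c ρ) (t, x))
    (hr : 0 < r) (hrt : r ≤ t - a)
    (hlow : ∀ τ ∈ Ioc 0 r, m * τ ≤ φ (t, x) - φ (t - τ, x))
    (hup : ∀ τ ∈ Ioc 0 r, φ (t, x) - φ (t - τ, x) ≤ C * τ) :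
    K α r u t x + H t x (u (t, x)) (spaceGrad φ t x) ≤ -(m * gcoef α * r ^ (1 - α)) := by
  have h := (hu.2.2 (t - r) b c ρ φ t x ⟨by linarith [ha.1], by linarith [ht.2, hb.2]⟩ hb
    (by linarith [ht.2]) hρ hφ ⟨by linarith, ht.2⟩ hx
    (hmax.on_subset (prod_mono (Icc_subset_Icc_left (by linarith)) subset_rfl))).2
  rw [sub_sub_cancel] at h
  have := le_J_of_bounds hα0 hα1 hφ.2.1 hr (by linarith [ha.1]) (ht.2.trans hb.2) hlow hup
  linarith

lemma exists_time_increment {φ : ℝ × Space d → ℝ} (hφ : ContDiffOn ℝ 1 φ (QT d T)) {t₀ : ℝ}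
    (ht₀ : t₀ ∈ Ioc 0 T) (x₀ : Space d) {ε : ℝ} (hε : 0 < ε) :
    ∃ δ > 0, ∀ t ∈ Ioc 0 T, ∀ x, |t - t₀| < δ → dist x x₀ < δ → ∀ τ ∈ Icc 0 δ,
      |φ (t, x) - φ (t - τ, x) - timeDeriv T φ t₀ x₀ * τ| ≤ ε * τ := by
  have hc := continuousOn_timeDeriv hφ (t₀, x₀) ⟨ht₀, mem_univ _⟩
  obtain ⟨δ₀, hδ₀, h⟩ := Metric.continuousWithinAt_iff.1 hc ε hε
  set m := timeDeriv T φ t₀ x₀ with hm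
  refine ⟨min (δ₀ / 3) (t₀ / 3), lt_min (by linarith) (by linarith [ht₀.1]), ?_⟩
  intro t ht x htt hx τ hτ
  have hd1 := min_le_left (δ₀ / 3) (t₀ / 3)
  have hd2 := min_le_right (δ₀ / 3) (t₀ / 3)
  rw [abs_lt] at htt
  have hsub : Icc (t - τ) t ⊆ Ioc 0 T := fun s hs =>
    ⟨by linarith [hs.1, hτ.2], hs.2.trans ht.2⟩
  have hder : ∀ s ∈ Icc (t - τ) t, HasDerivWithinAt (fun s => φ (s, x) - m * s)
      (timeDeriv T φ s x - m) (Icc (t - τ) t) s := fun s hs => by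
    have h1 := (hasDerivWithinAt_time hφ (hsub hs) x).mono hsub
    have h2 := h1.fun_sub ((hasDerivWithinAt_id s (Icc (t - τ) t)).const_mul m)
    rwa [mul_one] at h2
  have hbd : ∀ s ∈ Icc (t - τ) t, ‖timeDeriv T φ s x - m‖ ≤ ε := fun s hs => by
    have := h (show (s, x) ∈ QT d T from ⟨hsub hs, mem_univ _⟩) (by
      rw [Prod.dist_eq, max_lt_iff]
      refine ⟨?_, by linarith⟩
      simp only [Real.dist_eq, abs_lt]
      constructor <;> linarith [hs.1, hs.2, hτ.2])
    rw [Real.dist_eq] at this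
    exact this.le
  have := (convex_Icc (t - τ) t).norm_image_sub_le_of_norm_hasDerivWithin_le hder hbd
    (left_mem_Icc.2 (by linarith [hτ.1])) (right_mem_Icc.2 (by linarith [hτ.1]))
  rw [Real.norm_eq_abs, Real.norm_eq_abs, sub_sub_cancel, abs_of_nonneg hτ.1] at this
  refine le_trans (le_of_eq ?_) this
  congr 1; ring

lemma exists_lattice_near (d : ℕ) :
    ∃ R > 0, ∀ x x₀ : Space d, ∃ z : Fin d → ℤ, ‖x + latticeVec z - x₀‖ ≤ R := by
  refine ⟨Real.sqrt d + 1, by positivity, fun x x₀ => ⟨fun i => -⌊x i - x₀ i⌋, ?_⟩⟩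
  refine le_trans ?_ (le_add_of_nonneg_right zero_le_one)
  rw [EuclideanSpace.norm_eq]
  refine Real.sqrt_le_sqrt ?_
  have : ∀ i ∈ (Finset.univ : Finset (Fin d)),
      ‖(x + latticeVec (fun i => -⌊x i - x₀ i⌋) - x₀) i‖ ^ 2 ≤ 1 := fun i _ => by
    have h1 : (x + latticeVec (fun i => -⌊x i - x₀ i⌋) - x₀) i = Int.fract (x i - x₀ i) := by
      simp only [latticeVec, PiLp.sub_apply, PiLp.add_apply, Int.cast_neg]
      rw [← Int.self_sub_floor]; ring
    rw [h1, Real.norm_eq_abs, abs_of_nonneg (Int.fract_nonneg _)]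
    have := Int.fract_nonneg (x i - x₀ i)
    have := (Int.fract_lt_one (x i - x₀ i)).le
    nlinarith
  simpa using Finset.sum_le_sum this

lemma mem_QTbar {t : ℝ} {x : Space d} : (t, x) ∈ QTbar d T ↔ t ∈ Icc 0 T := by simp [QTbar]

lemma mem_QT {t : ℝ} {x : Space d} : (t, x) ∈ QT d T ↔ t ∈ Ioc 0 T := by simp [QT]

lemma exists_isMaxOn_QTbar (hT : 0 < T) {u φ : ℝ × Space d → ℝ}
    (hu : UpperSemicontinuousOn u (QTbar d T))
    (hper : ∀ t ∈ Icc 0 T, LatticePeriodic fun x => u (t, x)) (hφ : ContinuousOn φ (QTbar d T))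
    (x₀ : Space d)
    (hmono : ∀ t ∈ Icc 0 T, ∀ x y, ‖x - x₀‖ ≤ ‖y - x₀‖ → φ (t, x) ≤ φ (t, y)) :
    ∃ p ∈ QTbar d T, ∀ q ∈ QTbar d T, u q - φ q ≤ u p - φ p := by
  obtain ⟨R, hR, hlat⟩ := exists_lattice_near d
  have hsub : Icc 0 T ×ˢ Metric.closedBall x₀ R ⊆ QTbar d T := prod_mono subset_rfl (subset_univ _)
  have husc : UpperSemicontinuousOn (fun p => u p + -φ p) (Icc 0 T ×ˢ Metric.closedBall x₀ R) :=
    (hu.mono hsub).add (hφ.neg.mono hsub).upperSemicontinuousOn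
  obtain ⟨p, hp, hmax⟩ := husc.exists_isMaxOn
    ⟨(0, x₀), mk_mem_prod (left_mem_Icc.2 hT.le) (Metric.mem_closedBall_self hR.le)⟩
    (isCompact_Icc.prod (isCompact_closedBall x₀ R))
  refine ⟨p, hsub hp, ?_⟩
  rintro ⟨t, y⟩ hq
  rw [mem_QTbar] at hq
  have key : ∀ y, ‖y - x₀‖ ≤ R → u (t, y) - φ (t, y) ≤ u p - φ p := fun y hy =>
    hmax (show (t, y) ∈ Icc 0 T ×ˢ Metric.closedBall x₀ R from
      ⟨hq, by rwa [mem_closedBall_iff_norm]⟩)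
  by_cases hy : ‖y - x₀‖ ≤ R
  · exact key y hy
  · obtain ⟨z, hz⟩ := hlat y x₀
    have h1 := key _ hz
    have h2 := hmono t hq (y + latticeVec z) y (hz.trans (not_le.1 hy).le)
    have h3 : u (t, y + latticeVec z) = u (t, y) := hper t hq y z
    linarith

lemma rpow_sub_rpow_bounds {γ t τ : ℝ} (hγ0 : 0 < γ) (hγ1 : γ ≤ 1) (hτ : 0 < τ) (hτt : τ ≤ t) :
    γ * t ^ (γ - 1) * τ ≤ t ^ γ - (t - τ) ^ γ ∧ t ^ γ - (t - τ) ^ γ ≤ t ^ (γ - 1) * τ := by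
  have ht : 0 < t := hτ.trans_le hτt
  have hs1 : τ / t ≤ 1 := (div_le_one ht).2 hτt
  have hs0 : 0 < τ / t := div_pos hτ ht
  have h1 : (t - τ) ^ γ = t ^ γ * (1 - τ / t) ^ γ := by
    rw [← Real.mul_rpow ht.le (by linarith)]
    congr 1; field_simp
  have h2 : t ^ (γ - 1) * τ = t ^ γ * (τ / t) := by
    rw [Real.rpow_sub_one ht.ne']; ring
  have h3 : (1 - τ / t) ^ γ ≤ 1 - γ * (τ / t) := by
    have := rpow_one_add_le_one_add_mul_self (s := -(τ / t)) (by linarith) hγ0.le hγ1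
    simpa [sub_eq_add_neg] using this
  have h4 : 1 - τ / t ≤ (1 - τ / t) ^ γ :=
    Real.self_le_rpow_of_le_one (by linarith) (by linarith) hγ1
  have h5 := Real.rpow_pos_of_pos ht γ
  rw [h1, mul_assoc, h2]
  constructor <;> nlinarith

lemma gradient_quadratic (k c : ℝ) (x₀ x : Space d) :
    gradient (fun y => k * ‖y - x₀‖ ^ 2 + c) x = (2 * k) • (x - x₀) := by
  have h1 : HasFDerivAt (fun y : Space d => y - x₀) (ContinuousLinearMap.id ℝ (Space d)) x :=
    (hasFDerivAt_id x).sub_const x₀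
  have h2 := (h1.norm_sq.const_mul k).add_const c
  refine HasGradientAt.gradient ?_
  rw [hasGradientAt_iff_hasFDerivAt]
  have h3 : InnerProductSpace.toDual ℝ (Space d) ((2 * k) • (x - x₀)) =
      k • 2 • (innerSL ℝ) (x - x₀) ∘SL ContinuousLinearMap.id ℝ (Space d) := by
    ext v
    simp
    ring
  rw [h3]
  exact h2

lemma isTestFunction_rpow {γ : ℝ} (hγ : 0 < γ) (C : ℝ) :
    IsTestFunction T fun p : ℝ × Space d => C * p.1 ^ γ := by
  refine ⟨?_, ?_, fun x => ?_⟩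
  · refine contDiffOn_const.mul (ContDiffOn.rpow_const_of_ne contDiff_fst.contDiffOn ?_)
    exact fun p hp => hp.1.1.ne'
  · exact (continuous_const.mul
      ((Real.continuous_rpow_const hγ.le).comp continuous_fst)).continuousOn
  · have h1 : IntegrableOn (fun t : ℝ => C * (γ * t ^ (γ - 1))) (Ioo 0 T) := by
      rcases le_or_gt T 0 with hT | hT
      · simp [Ioo_eq_empty_of_le hT]
      have := (((intervalIntegral.intervalIntegrable_rpow' (a := 0) (b := T) (r := γ - 1)
        (by linarith)).const_mul γ).const_mul C)
      rw [intervalIntegrable_iff_integrableOn_Ioo_of_le hT.le] at this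
      exact this
    refine h1.congr_fun (fun t ht => ?_) measurableSet_Ioo
    exact ((Real.hasDerivAt_rpow_const (p := γ) (Or.inl ht.1.ne')).const_mul C).deriv.symm

lemma contDiff_quadratic (m k : ℝ) (x₀ : Space d) :
    ContDiff ℝ 1 fun p : ℝ × Space d => m + k * ‖p.2 - x₀‖ ^ 2 :=
  contDiff_const.add (contDiff_const.mul ((contDiff_snd.sub contDiff_const).norm_sq ℝ))

lemma inv_le_rpow_sub {S t γ α : ℝ} (hγ0 : 0 < γ) (hγα : γ ≤ α) (hα1 : α < 1) (ht : 0 < t)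
    (htS : t ≤ S) (hS : 1 ≤ S) : S⁻¹ ≤ t ^ (γ - α) := by
  calc S⁻¹ = S ^ (-1 : ℝ) := (Real.rpow_neg_one S).symm
    _ ≤ S ^ (γ - α) := Real.rpow_le_rpow_of_exponent_le hS (by linarith)
    _ ≤ t ^ (γ - α) := Real.rpow_le_rpow_of_nonpos ht htS (by linarith)

/-- Comparison of a subsolution with the barrier `m + k |x - x₀|² + C t ^ γ`. -/
lemma IsFracSubsolution.le_barrier {u : ℝ × Space d → ℝ} {H : ℝ → Space d → ℝ → Space d → ℝ}
    {α γ m k C g S : ℝ} {x₀ : Space d} (hT : 0 < T) (hu : IsFracSubsolution T α H u)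
    (hγ0 : 0 < γ) (hγα : γ ≤ α) (hα1 : α < 1) (hk : 0 ≤ k) (hC : 0 ≤ C) (hS1 : 1 ≤ S)
    (hTS : T ≤ S) (hg0 : 0 ≤ g) (hg : g ≤ gcoef α) (hinit : ∀ x, u (0, x) ≤ m + k * ‖x - x₀‖ ^ 2)
    (hH : ∀ t ∈ Ioc 0 T, ∀ x, m + k * ‖x - x₀‖ ^ 2 ≤ u (t, x) →
      -(C * γ * g * S⁻¹) < H t x (u (t, x)) ((2 * k) • (x - x₀))) :
    ∀ t ∈ Icc 0 T, ∀ x, u (t, x) ≤ m + k * ‖x - x₀‖ ^ 2 + C * t ^ γ := by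
  set φ : ℝ × Space d → ℝ := fun p => (m + k * ‖p.2 - x₀‖ ^ 2) + C * p.1 ^ γ with hφdef
  have hφ : IsTestFunction T φ :=
    (isTestFunction_of_contDiff (contDiff_quadratic m k x₀)).add (isTestFunction_rpow hγ0 C)
  obtain ⟨⟨t, x⟩, hp, hmax⟩ := exists_isMaxOn_QTbar hT hu.1 hu.2.1 hφ.2.1 x₀ (by
    intro t _ y z hyz
    have : ‖y - x₀‖ ^ 2 ≤ ‖z - x₀‖ ^ 2 := by gcongr
    simp only [hφdef]
    gcongr)
  rw [mem_QTbar] at hp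
  suffices hle : u (t, x) - φ (t, x) ≤ 0 by
    intro s hs y
    have := hmax (s, y) (mem_QTbar.2 hs)
    simp only [hφdef] at this hle
    linarith
  by_contra! hpos
  have h0φ : ∀ y, φ (0, y) = m + k * ‖y - x₀‖ ^ 2 := fun y => by
    simp [hφdef, Real.zero_rpow hγ0.ne']
  have ht0 : 0 < t := by
    rcases hp.1.eq_or_lt with h | h
    · subst h
      rw [h0φ] at hpos
      linarith [hinit x]
    · exact h
  have htγ := Real.rpow_pos_of_pos ht0 γ
  have hux : m + k * ‖x - x₀‖ ^ 2 ≤ u (t, x) := by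
    simp only [hφdef] at hpos
    have := mul_nonneg hC htγ.le
    linarith
  have hb : ∀ τ ∈ Ioc 0 t, φ (t, x) - φ (t - τ, x) = C * (t ^ γ - (t - τ) ^ γ) := fun τ _ => by
    simp only [hφdef]; ring
  have hα0 : 0 < α := hγ0.trans_le hγα
  have key := hu.K_add_le (a := 0) (b := T) (c := x) (ρ := 1) (t := t) (x := x) (r := t)
    (m := C * (γ * t ^ (γ - 1))) (C := C * t ^ (γ - 1)) hα0 hα1 (left_mem_Icc.2 hT.le)
    (right_mem_Icc.2 hT.le) one_pos hφ ⟨ht0, hp.2⟩ (Metric.mem_ball_self one_pos)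
    (fun q hq => hmax q ⟨hq.1, mem_univ _⟩) ht0 (by linarith)
    (fun τ hτ => by
      rw [hb τ hτ, mul_assoc]
      exact mul_le_mul_of_nonneg_left
        (rpow_sub_rpow_bounds hγ0 (by linarith) hτ.1 hτ.2).1 hC)
    (fun τ hτ => by
      rw [hb τ hτ, mul_assoc]
      exact mul_le_mul_of_nonneg_left
        (rpow_sub_rpow_bounds hγ0 (by linarith) hτ.1 hτ.2).2 hC)
  have hgrad : spaceGrad φ t x = (2 * k) • (x - x₀) := by
    rw [← gradient_quadratic k (m + C * t ^ γ) x₀ x]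
    simp only [spaceGrad, hφdef]
    congr 1; funext y; ring
  have hK : 0 ≤ K α t u t x := by
    rw [K, intervalIntegral.integral_same, mul_zero, add_zero]
    refine div_nonneg ?_ (mul_nonneg (Real.rpow_nonneg ht0.le _)
      (Real.Gamma_pos_of_pos (by linarith)).le)
    have h1 := hmax (0, x) (mem_QTbar.2 (left_mem_Icc.2 hT.le))
    rw [h0φ] at h1
    linarith [hinit x]
  have hHl := hH t ⟨ht0, hp.2⟩ x hux
  rw [hgrad] at key
  have hpow : C * (γ * t ^ (γ - 1)) * gcoef α * t ^ (1 - α) = C * γ * gcoef α * t ^ (γ - α) := by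
    rw [show γ - α = (γ - 1) + (1 - α) by ring, Real.rpow_add ht0]; ring
  rw [hpow] at key
  have h2 : C * γ * g * S⁻¹ ≤ C * γ * gcoef α * t ^ (γ - α) := by
    have := inv_le_rpow_sub hγ0 hγα hα1 ht0 (hp.2.trans hTS) hS1
    have h0 : 0 ≤ gcoef α := hg0.trans hg
    gcongr
  linarith

/-- A lower bound for the Hamiltonian on compact sets of base points and momenta. -/
lemma IsHamiltonian.exists_lower_bound {H : ℝ → Space d → ℝ → Space d → ℝ}
    (hH : IsHamiltonian T H) (m R : ℝ) (x₀ : Space d) :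
    ∃ B > 0, ∀ t ∈ Icc 0 T, ∀ x p, ‖p‖ ≤ R → ∀ r, m ≤ r → -B < H t x r p := by
  obtain ⟨R₀, hR₀, hlat⟩ := exists_lattice_near d
  have hcomp : IsCompact (Icc 0 T ×ˢ (Metric.closedBall x₀ R₀ ×ˢ
      (({m} : Set ℝ) ×ˢ Metric.closedBall (0 : Space d) R))) :=
    isCompact_Icc.prod ((isCompact_closedBall _ _).prod
      (isCompact_singleton.prod (isCompact_closedBall _ _)))
  obtain ⟨B, hB⟩ := hcomp.exists_bound_of_continuousOn
    (hH.continuousOn.mono (prod_mono subset_rfl (subset_univ _)))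
  refine ⟨|B| + 1, by positivity, fun t ht x p hp r hr => ?_⟩
  obtain ⟨z, hz⟩ := hlat x x₀
  have h1 : H t (x + latticeVec z) m p = H t x m p := hH.periodic t ht m p x z
  have h2 := hB (t, x + latticeVec z, m, p) ⟨ht, mem_closedBall_iff_norm.2 hz, rfl,
    mem_closedBall_zero_iff.2 hp⟩
  have h3 : H t x m p ≤ H t x r p := hH.mono t ht x p hr
  rw [Real.norm_eq_abs] at h2
  simp only [h1] at h2
  have := neg_abs_le (H t x m p)
  have := le_abs_self B
  linarith

lemma exists_gcoef_lower {γ : ℝ} (hγ : 0 < γ) : ∃ g > 0, ∀ α, γ ≤ α → α < 1 → g ≤ gcoef α := by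
  rcases lt_or_ge γ 1 with h | h
  · obtain ⟨a, ha, hmin⟩ := isCompact_Icc.exists_isMinOn (nonempty_Icc.2 h.le)
      (continuous_gcoef.continuousOn (s := Icc γ 1))
    exact ⟨gcoef a, gcoef_pos (hγ.trans_le ha.1) ha.2, fun α h1 h2 => hmin ⟨h1, h2.le⟩⟩
  · exact ⟨1, one_pos, fun α h1 h2 => by linarith⟩

lemma exists_bound_periodic {f : Space d → ℝ} (hf : Continuous f) (hper : LatticePeriodic f) :
    ∃ B, ∀ x, f x ≤ B := by
  obtain ⟨R₀, hR₀, hlat⟩ := exists_lattice_near d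
  obtain ⟨B, hB⟩ := (isCompact_closedBall (0 : Space d) R₀).exists_bound_of_continuousOn
    hf.continuousOn
  refine ⟨B, fun x => ?_⟩
  obtain ⟨z, hz⟩ := hlat x 0
  have := hB _ (mem_closedBall_iff_norm.2 hz)
  rw [hper x z] at this
  exact (le_abs_self _).trans this

/-- A uniform upper bound for subsolutions with common initial data. -/
lemma exists_uniform_bound (hT : 0 < T) {H : ℝ → Space d → ℝ → Space d → ℝ}
    (hH : IsHamiltonian T H) {u₀ : Space d → ℝ} (hu₀ : Continuous u₀) (hper : LatticePeriodic u₀)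
    {γ : ℝ} (hγ : 0 < γ) :
    ∃ M, ∀ α u, γ ≤ α → α < 1 → IsFracSubsolution T α H u → (∀ x, u (0, x) = u₀ x) →
      ∀ t ∈ Icc 0 T, ∀ x, u (t, x) ≤ M := by
  obtain ⟨m, hm⟩ := exists_bound_periodic hu₀ hper
  obtain ⟨B, hB, hBH⟩ := hH.exists_lower_bound m 0 0
  obtain ⟨g, hg, hgα⟩ := exists_gcoef_lower hγ
  set S := max 1 T with hS
  have hS1 : 1 ≤ S := le_max_left _ _
  have hS0 : 0 < S := by linarith
  refine ⟨m + B / (γ * g * S⁻¹) * T ^ γ, fun α u h1 h2 hu hu0 t ht x => ?_⟩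
  have hC : 0 ≤ B / (γ * g * S⁻¹) := by positivity
  have := hu.le_barrier (m := m) (k := 0) (C := B / (γ * g * S⁻¹)) (x₀ := 0) hT hγ h1 h2 le_rfl hC
    hS1 (le_max_right _ _) hg.le (hgα α h1 h2) (fun x => by rw [hu0]; simpa using hm x)
    (fun t ht x hx => by
      have h3 := hBH t (Ioc_subset_Icc_self ht) x ((2 * 0 : ℝ) • (x - 0)) (by simp) (u (t, x))
        (by simpa using hx)
      refine lt_of_le_of_lt (le_of_eq ?_) h3
      field_simp) t ht x
  have h3 : t ^ γ ≤ T ^ γ := Real.rpow_le_rpow ht.1 ht.2 hγ.le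
  have h4 := mul_le_mul_of_nonneg_left h3 hC
  simp only [zero_mul, add_zero] at this
  linarith

lemma exists_quadratic_majorant {f : Space d → ℝ} (hf : Continuous f) (hper : LatticePeriodic f)
    (x₀ : Space d) {ε : ℝ} (hε : 0 < ε) :
    ∃ k > 0, ∀ x, f x ≤ f x₀ + ε + k * ‖x - x₀‖ ^ 2 := by
  obtain ⟨B, hB⟩ := exists_bound_periodic hf hper
  obtain ⟨δ, hδ, h⟩ := Metric.continuousAt_iff.1 (hf.continuousAt (x := x₀)) ε hε
  have hB0 : 0 ≤ B - f x₀ := by linarith [hB x₀]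
  refine ⟨(B - f x₀ + 1) / δ ^ 2, by positivity, fun x => ?_⟩
  rcases lt_or_ge (dist x x₀) δ with hx | hx
  · have h1 := h hx
    rw [Real.dist_eq, abs_lt] at h1
    have : 0 ≤ (B - f x₀ + 1) / δ ^ 2 * ‖x - x₀‖ ^ 2 := by positivity
    linarith
  · rw [dist_eq_norm] at hx
    have h1 : δ ^ 2 ≤ ‖x - x₀‖ ^ 2 := by gcongr
    have h2 : B - f x₀ + 1 ≤ (B - f x₀ + 1) / δ ^ 2 * ‖x - x₀‖ ^ 2 := by
      rw [div_mul_eq_mul_div, le_div_iff₀ (by positivity)]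
      gcongr
    linarith [hB x]

/-- A uniform modulus at `t = 0` for subsolutions with common initial data. -/
lemma exists_uniform_initial (hT : 0 < T) {H : ℝ → Space d → ℝ → Space d → ℝ}
    (hH : IsHamiltonian T H) {u₀ : Space d → ℝ} (hu₀ : Continuous u₀) (hper : LatticePeriodic u₀)
    {γ : ℝ} (hγ : 0 < γ) (x₀ : Space d) {ε : ℝ} (hε : 0 < ε) :
    ∃ k C, ∀ α u, γ ≤ α → α < 1 → IsFracSubsolution T α H u → (∀ x, u (0, x) = u₀ x) →
      ∀ t ∈ Icc 0 T, ∀ x, u (t, x) ≤ u₀ x₀ + ε + k * ‖x - x₀‖ ^ 2 + C * t ^ γ := by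
  obtain ⟨M, hM⟩ := exists_uniform_bound hT hH hu₀ hper hγ
  obtain ⟨k, hk, hmaj⟩ := exists_quadratic_majorant hu₀ hper x₀ hε
  set m := u₀ x₀ + ε with hm
  set R := 2 * k * Real.sqrt (|M - m| / k) with hR
  obtain ⟨B, hB, hBH⟩ := hH.exists_lower_bound m R 0
  obtain ⟨g, hg, hgα⟩ := exists_gcoef_lower hγ
  set S := max 1 T with hS
  have hS1 : 1 ≤ S := le_max_left _ _
  have hS0 : 0 < S := by linarith
  refine ⟨k, B / (γ * g * S⁻¹), fun α u h1 h2 hu hu0 => ?_⟩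
  have hC : 0 ≤ B / (γ * g * S⁻¹) := by positivity
  refine hu.le_barrier hT hγ h1 h2 hk.le hC hS1 (le_max_right _ _) hg.le (hgα α h1 h2)
    (fun x => by rw [hu0]; exact hmaj x) (fun t ht x hx => ?_)
  have hub := hM α u h1 h2 hu hu0 t (Ioc_subset_Icc_self ht) x
  have hnorm : ‖x - x₀‖ ≤ Real.sqrt (|M - m| / k) := by
    refine Real.le_sqrt_of_sq_le ?_
    rw [le_div_iff₀ hk]
    linarith [le_abs_self (M - m)]
  have h3 := hBH t (Ioc_subset_Icc_self ht) x ((2 * k) • (x - x₀)) (by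
    rw [norm_smul, Real.norm_eq_abs, abs_of_pos (by positivity)]
    exact mul_le_mul_of_nonneg_left hnorm (by positivity)) (u (t, x)) (by
      have : 0 ≤ k * ‖x - x₀‖ ^ 2 := by positivity
      linarith)
  refine lt_of_le_of_lt (le_of_eq ?_) h3
  field_simp

/-- The integrand of `K`, extended by zero to `τ > t`. -/
noncomputable def truncDiff (α : ℝ) (f : ℝ × Space d → ℝ) (t : ℝ) (x : Space d) : ℝ → ℝ :=
  (Iic t).indicator (kernelDiff α f t x)

lemma truncDiff_of_le {α t τ : ℝ} {f : ℝ × Space d → ℝ} {x : Space d} (h : τ ≤ t) :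
    truncDiff α f t x τ = (f (t, x) - f (t - τ, x)) / τ ^ (α + 1) :=
  indicator_of_mem (s := Iic t) h _

lemma truncDiff_of_lt {α t τ : ℝ} {f : ℝ × Space d → ℝ} {x : Space d} (h : t < τ) :
    truncDiff α f t x τ = 0 := indicator_of_notMem (s := Iic t) (by simpa using h) _

lemma integral_kernelDiff_eq {α t r : ℝ} {f : ℝ × Space d → ℝ} {x : Space d} (hrt : r ≤ t)
    (htT : t ≤ T) :
    ∫ τ in r..t, kernelDiff α f t x τ = ∫ τ in Ioc r T, truncDiff α f t x τ := by
  rw [intervalIntegral.integral_of_le hrt, truncDiff, setIntegral_indicator measurableSet_Iic]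
  congr 2
  ext τ
  simp only [mem_inter_iff, mem_Ioc, mem_Iic]
  constructor
  · exact fun h => ⟨⟨h.1, h.2.trans htT⟩, h.2⟩
  · exact fun h => ⟨h.1.1, h.2⟩

lemma min_sq_le_rpow {α r τ : ℝ} (hα0 : 0 < α) (hα1 : α ≤ 1) (hr : 0 < r) (hrτ : r ≤ τ) :
    min r 1 ^ 2 ≤ τ ^ (α + 1) := by
  have h0 : 0 < min r 1 := lt_min hr one_pos
  calc min r 1 ^ 2 = min r 1 ^ (2 : ℝ) := (Real.rpow_natCast _ 2).symm
    _ ≤ min r 1 ^ (α + 1) :=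
      Real.rpow_le_rpow_of_exponent_ge h0 (min_le_right _ _) (by linarith)
    _ ≤ τ ^ (α + 1) := Real.rpow_le_rpow h0.le ((min_le_left _ _).trans hrτ) (by linarith)

lemma abs_truncDiff_le {α r t τ M : ℝ} {f : ℝ × Space d → ℝ} {x : Space d} (hα0 : 0 < α)
    (hα1 : α ≤ 1) (hr : 0 < r) (hrτ : r ≤ τ) (ht : t ∈ Icc 0 T)
    (hM : ∀ p ∈ QTbar d T, |f p| ≤ M) :
    |truncDiff α f t x τ| ≤ 2 * M / min r 1 ^ 2 := by
  have hM0 : 0 ≤ M := (abs_nonneg _).trans (hM (t, x) (mem_QTbar.2 ht))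
  rcases le_or_gt τ t with h | h
  · have h0 : 0 < τ := hr.trans_le hrτ
    have h1 := abs_le.1 (hM (t, x) (mem_QTbar.2 ht))
    have h2 := abs_le.1 (hM (t - τ, x) (mem_QTbar.2 ⟨by linarith, by linarith [ht.2]⟩))
    rw [truncDiff_of_le h, abs_div, abs_of_pos (Real.rpow_pos_of_pos h0 _)]
    refine div_le_div₀ (by linarith) ?_ (pow_pos (lt_min hr one_pos) 2)
      (min_sq_le_rpow hα0 hα1 hr hrτ)
    rw [abs_le]; constructor <;> linarith
  · rw [truncDiff_of_lt h, abs_zero]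
    positivity

lemma aestronglyMeasurable_truncDiff {α r t : ℝ} {f : ℝ × Space d → ℝ} {x : Space d}
    (hr : 0 < r) (ht : t ∈ Icc 0 T) (hf : UpperSemicontinuousOn f (QTbar d T)) :
    AEStronglyMeasurable (truncDiff α f t x) (volume.restrict (Ioc r T)) := by
  rw [truncDiff, aestronglyMeasurable_indicator_iff measurableSet_Iic,
    Measure.restrict_restrict measurableSet_Iic]
  have hs : MeasurableSet (Iic t ∩ Ioc r T) := measurableSet_Iic.inter measurableSet_Ioc
  have hmaps : MapsTo (fun τ : ℝ => ((t - τ, x) : ℝ × Space d)) (Iic t ∩ Ioc r T) (QTbar d T) :=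
    fun τ hτ => mem_QTbar.2 ⟨by linarith [show τ ≤ t from hτ.1], by linarith [hτ.2.1, ht.2]⟩
  have husc : UpperSemicontinuousOn (fun τ : ℝ => f (t - τ, x)) (Iic t ∩ Ioc r T) := by
    intro τ hτ c hc
    have hcont : ContinuousWithinAt (fun τ : ℝ => ((t - τ, x) : ℝ × Space d))
        (Iic t ∩ Ioc r T) τ := by fun_prop
    exact (hcont.tendsto_nhdsWithin hmaps).eventually (hf _ (hmaps hτ) c hc)
  have hmeas : AEMeasurable (fun τ : ℝ => f (t - τ, x)) (volume.restrict (Iic t ∩ Ioc r T)) :=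
    aemeasurable_restrict_of_measurable_subtype hs
      (upperSemicontinuousOn_iff_restrict.2 husc).measurable
  refine AEMeasurable.aestronglyMeasurable ?_
  exact (aemeasurable_const.sub hmeas).div (by fun_prop)

lemma integrableOn_truncDiff {α r t M : ℝ} {f : ℝ × Space d → ℝ} {x : Space d} (hα0 : 0 < α)
    (hα1 : α ≤ 1) (hr : 0 < r) (ht : t ∈ Icc 0 T) (hf : UpperSemicontinuousOn f (QTbar d T))
    (hM : ∀ p ∈ QTbar d T, |f p| ≤ M) : IntegrableOn (truncDiff α f t x) (Ioc r T) := by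
  refine Integrable.mono' (g := fun _ => 2 * M / min r 1 ^ 2) (integrableOn_const (by simp))
    (aestronglyMeasurable_truncDiff hr ht hf) ?_
  exact (ae_restrict_iff' measurableSet_Ioc).2 (Eventually.of_forall fun τ hτ =>
    abs_truncDiff_le hα0 hα1 hr hτ.1.le ht hM)

section KLiminf

variable {α : ℕ → ℝ} {V : ℕ → ℝ × Space d → ℝ} {v : ℝ × Space d → ℝ} {β M t₀ r : ℝ}
  {t : ℕ → ℝ} {x : ℕ → Space d} {x₀ : Space d}

lemma tendsto_truncDiff_posPart (hα : Tendsto α atTop (𝓝 β)) (ht : Tendsto t atTop (𝓝 t₀))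
    (hx : Tendsto x atTop (𝓝 x₀)) (htm : ∀ n, t n ∈ Icc 0 T) (ht₀ : t₀ ∈ Icc 0 T)
    (hval : Tendsto (fun n => V n (t n, x n)) atTop (𝓝 (v (t₀, x₀))))
    (hlim : ∀ p ∈ QTbar d T, ∀ q : ℕ → ℝ × Space d, (∀ᶠ n in atTop, q n ∈ QTbar d T) →
      Tendsto q atTop (𝓝 p) → ∀ c, v p < c → ∀ᶠ n in atTop, V n (q n) < c)
    {τ : ℝ} (hτ : 0 < τ) (hne : τ ≠ t₀) :
    Tendsto (fun n => max (truncDiff β v t₀ x₀ τ - truncDiff (α n) (V n) (t n) (x n) τ) 0) atTop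
      (𝓝 0) := by
  rcases hne.lt_or_gt with h | h
  · have hlt : ∀ᶠ n in atTop, τ < t n := ht.eventually (lt_mem_nhds h)
    rw [tendsto_order]
    refine ⟨fun a ha => Eventually.of_forall fun n => ha.trans_le (le_max_right _ _), fun ε hε => ?_⟩
    have hpos := Real.rpow_pos_of_pos hτ (β + 1)
    set c := v (t₀ - τ, x₀) + ε / 2 * τ ^ (β + 1) with hc
    have hcv : v (t₀ - τ, x₀) < c := lt_add_of_pos_right _ (by positivity)
    have h1 := hlim (t₀ - τ, x₀) (mem_QTbar.2 ⟨by linarith, by linarith [ht₀.2]⟩)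
      (fun n => (t n - τ, x n))
      (hlt.mono fun n hn => mem_QTbar.2 ⟨by linarith, by linarith [(htm n).2]⟩)
      ((ht.sub_const τ).prodMk_nhds hx) c hcv
    have hpow : Tendsto (fun n => τ ^ (α n + 1)) atTop (𝓝 (τ ^ (β + 1))) :=
      tendsto_const_nhds.rpow (hα.add_const 1) (Or.inl hτ.ne')
    have h2 : Tendsto (fun n => truncDiff β v t₀ x₀ τ - (V n (t n, x n) - c) / τ ^ (α n + 1)) atTop
        (𝓝 (truncDiff β v t₀ x₀ τ - (v (t₀, x₀) - c) / τ ^ (β + 1))) :=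
      tendsto_const_nhds.sub ((hval.sub_const c).div hpow hpos.ne')
    have h3 : truncDiff β v t₀ x₀ τ - (v (t₀, x₀) - c) / τ ^ (β + 1) < ε := by
      rw [truncDiff_of_le h.le, ← sub_div, hc, div_lt_iff₀ hpos]
      nlinarith [mul_pos hε hpos]
    filter_upwards [h1, hlt, h2.eventually (gt_mem_nhds h3)] with n hn1 hn2 hn3
    refine max_lt (lt_of_le_of_lt ?_ hn3) hε
    rw [truncDiff_of_le (f := V n) hn2.le]
    have := Real.rpow_pos_of_pos hτ (α n + 1)
    gcongr
  · have hlt : ∀ᶠ n in atTop, t n < τ := ht.eventually (gt_mem_nhds h)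
    refine tendsto_const_nhds.congr' ?_
    filter_upwards [hlt] with n hn
    rw [truncDiff_of_lt h, truncDiff_of_lt hn, sub_zero, max_self]

/-- Lower semicontinuity of the nonlocal operator along relaxed limits. -/
lemma eventually_lt_K (hβ0 : 0 < β) (hβ1 : β ≤ 1) (hα : Tendsto α atTop (𝓝 β))
    (hαI : ∀ n, α n ∈ Ioo (0 : ℝ) 1) (hV : ∀ n, UpperSemicontinuousOn (V n) (QTbar d T))
    (hv : UpperSemicontinuousOn v (QTbar d T)) (hVM : ∀ n, ∀ p ∈ QTbar d T, |V n p| ≤ M)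
    (hvM : ∀ p ∈ QTbar d T, |v p| ≤ M) (ht : Tendsto t atTop (𝓝 t₀))
    (hx : Tendsto x atTop (𝓝 x₀)) (htm : ∀ n, t n ∈ Icc 0 T) (ht₀ : t₀ ∈ Ioc 0 T)
    (hval : Tendsto (fun n => V n (t n, x n)) atTop (𝓝 (v (t₀, x₀))))
    (hinit : Tendsto (fun n => V n (0, x n)) atTop (𝓝 (v (0, x₀))))
    (hlim : ∀ p ∈ QTbar d T, ∀ q : ℕ → ℝ × Space d, (∀ᶠ n in atTop, q n ∈ QTbar d T) →
      Tendsto q atTop (𝓝 p) → ∀ c, v p < c → ∀ᶠ n in atTop, V n (q n) < c)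
    (hr : r ∈ Ioo 0 t₀) {A : ℝ} (hA : A < K β r v t₀ x₀) :
    ∀ᶠ n in atTop, A < K (α n) r (V n) (t n) (x n) := by
  have ht₀' : t₀ ∈ Icc 0 T := Ioc_subset_Icc_self ht₀
  set e : ℕ → ℝ := fun n => ∫ τ in Ioc r T,
    max (truncDiff β v t₀ x₀ τ - truncDiff (α n) (V n) (t n) (x n) τ) 0 with he
  have hint : IntegrableOn (truncDiff β v t₀ x₀) (Ioc r T) :=
    integrableOn_truncDiff hβ0 hβ1 hr.1 ht₀' hv hvM
  have hintn : ∀ n, IntegrableOn (truncDiff (α n) (V n) (t n) (x n)) (Ioc r T) := fun n =>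
    integrableOn_truncDiff (hαI n).1 (hαI n).2.le hr.1 (htm n) (hV n) (hVM n)
  have he0 : Tendsto e atTop (𝓝 0) := by
    have := tendsto_integral_of_dominated_convergence (μ := volume.restrict (Ioc r T))
      (F := fun n τ => max (truncDiff β v t₀ x₀ τ - truncDiff (α n) (V n) (t n) (x n) τ) 0)
      (f := fun _ => 0) (fun _ => 2 * (2 * M / min r 1 ^ 2))
      (fun n => ((hint.sub (hintn n)).pos_part).aestronglyMeasurable)
      (integrableOn_const (by simp))
      (fun n => (ae_restrict_iff' measurableSet_Ioc).2 (Eventually.of_forall fun τ hτ => by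
        have h1 := abs_le.1 (abs_truncDiff_le (x := x₀) hβ0 hβ1 hr.1 hτ.1.le ht₀' hvM)
        have h2 := abs_le.1 (abs_truncDiff_le (x := x n) (hαI n).1 (hαI n).2.le hr.1 hτ.1.le
          (htm n) (hVM n))
        rw [Real.norm_eq_abs, abs_of_nonneg (le_max_right _ _)]
        exact max_le (by linarith) (by linarith)))
      (by
        have hne : ∀ᵐ τ ∂(volume.restrict (Ioc r T)), τ ≠ t₀ :=
          ae_restrict_of_ae (by simp [ae_iff])
        filter_upwards [hne, ae_restrict_mem measurableSet_Ioc] with τ h1 h2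
        exact tendsto_truncDiff_posPart hα ht hx htm ht₀' hval hlim (hr.1.trans h2.1) h1)
    simpa using this
  set I := ∫ τ in Ioc r T, truncDiff β v t₀ x₀ τ with hI
  have hin : ∀ n, I - e n ≤ ∫ τ in Ioc r T, truncDiff (α n) (V n) (t n) (x n) τ := fun n => by
    have h1 : ∫ τ in Ioc r T, (truncDiff β v t₀ x₀ τ - truncDiff (α n) (V n) (t n) (x n) τ) ≤ e n :=
      integral_mono (hint.sub (hintn n)) ((hint.sub (hintn n)).pos_part)
        (fun τ => le_max_left _ _)
    rw [integral_sub hint (hintn n)] at h1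
    linarith
  have hΓ : Tendsto (fun n => (Real.Gamma (1 - α n))⁻¹) atTop (𝓝 (Real.Gamma (1 - β))⁻¹) :=
    (continuous_inv_Gamma.tendsto _).comp (tendsto_const_nhds.sub hα)
  have hpow : Tendsto (fun n => (t n ^ α n)⁻¹) atTop (𝓝 (t₀ ^ β)⁻¹) :=
    (ht.rpow hα (Or.inl ht₀.1.ne')).inv₀ (Real.rpow_pos_of_pos ht₀.1 _).ne'
  have hlimit : Tendsto (fun n => (V n (t n, x n) - V n (0, x n)) * ((t n ^ α n)⁻¹ *
      (Real.Gamma (1 - α n))⁻¹) + α n * (Real.Gamma (1 - α n))⁻¹ * (I - e n)) atTop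
      (𝓝 ((v (t₀, x₀) - v (0, x₀)) * ((t₀ ^ β)⁻¹ * (Real.Gamma (1 - β))⁻¹) +
        β * (Real.Gamma (1 - β))⁻¹ * (I - 0))) :=
    ((hval.sub hinit).mul (hpow.mul hΓ)).add ((hα.mul hΓ).mul (tendsto_const_nhds.sub he0))
  have hKβ : K β r v t₀ x₀ = (v (t₀, x₀) - v (0, x₀)) * ((t₀ ^ β)⁻¹ * (Real.Gamma (1 - β))⁻¹) +
        β * (Real.Gamma (1 - β))⁻¹ * (I - 0) := by
    rw [K, integral_kernelDiff_eq hr.2.le ht₀.2, div_eq_mul_inv, mul_inv, div_eq_mul_inv, sub_zero]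
  rw [hKβ] at hA
  filter_upwards [hlimit.eventually (lt_mem_nhds hA), ht.eventually (lt_mem_nhds hr.2)] with n h1 h2
  refine h1.trans_le ?_
  rw [K, integral_kernelDiff_eq h2.le (htm n).2, div_eq_mul_inv, mul_inv, div_eq_mul_inv (α n)]
  have h3 : 0 ≤ α n * (Real.Gamma (1 - α n))⁻¹ :=
    mul_nonneg (hαI n).1.le (inv_nonneg.2 (Real.Gamma_pos_of_pos (by linarith [(hαI n).2])).le)
  have := mul_le_mul_of_nonneg_left (hin n) h3
  linarith

end KLiminf

/-- The upper half-relaxed limit of the family `U` along the filter `F`. -/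
noncomputable def relaxedSup (T : ℝ) (F : Filter ℝ) (U : ℝ → ℝ × Space d → ℝ) (p : ℝ × Space d) :
    ℝ :=
  limsup (fun q : ℝ × (ℝ × Space d) => U q.1 q.2) (F ×ˢ 𝓝[QTbar d T] p)

section RelaxedSup

variable {F : Filter ℝ} {U : ℝ → ℝ × Space d → ℝ} {M : ℝ}
  (hM : ∀ᶠ α in F, ∀ p ∈ QTbar d T, |U α p| ≤ M) {p : ℝ × Space d}
include hM

lemma eventually_abs_le (p : ℝ × Space d) :
    ∀ᶠ q : ℝ × (ℝ × Space d) in F ×ˢ 𝓝[QTbar d T] p, |U q.1 q.2| ≤ M := by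
  filter_upwards [hM.prod_mk (eventually_mem_nhdsWithin (s := QTbar d T) (a := p))] with q hq
  exact hq.1 q.2 hq.2

lemma eventually_lt_of_relaxedSup_lt {c : ℝ} (h : relaxedSup T F U p < c) :
    ∀ᶠ q : ℝ × (ℝ × Space d) in F ×ˢ 𝓝[QTbar d T] p, U q.1 q.2 < c :=
  eventually_lt_of_limsup_lt h (isBoundedUnder_of_eventually_le
    ((eventually_abs_le hM p).mono fun _ hq => (le_abs_self _).trans hq))

lemma isCoboundedUnder_relaxed [F.NeBot] (hp : p ∈ QTbar d T) :
    IsCoboundedUnder (· ≤ ·) (F ×ˢ 𝓝[QTbar d T] p)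
      fun q : ℝ × (ℝ × Space d) => U q.1 q.2 := by
  have : (𝓝[QTbar d T] p).NeBot := mem_closure_iff_nhdsWithin_neBot.1 (subset_closure hp)
  exact (isBoundedUnder_of_eventually_ge (a := -M)
    ((eventually_abs_le hM p).mono fun _ hq => (abs_le.1 hq).1)).isCoboundedUnder_le

lemma relaxedSup_le [F.NeBot] (hp : p ∈ QTbar d T) {c : ℝ}
    (h : ∀ᶠ q : ℝ × (ℝ × Space d) in F ×ˢ 𝓝[QTbar d T] p, U q.1 q.2 ≤ c) :
    relaxedSup T F U p ≤ c :=
  limsup_le_of_le (isCoboundedUnder_relaxed hM hp) h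

lemma le_relaxedSup [F.NeBot] (hp : p ∈ QTbar d T) {c : ℝ} (h : ∀ᶠ α in F, c ≤ U α p) :
    c ≤ relaxedSup T F U p := by
  by_contra! hlt
  have h1 := eventually_lt_of_relaxedSup_lt hM hlt
  have h2 : ∀ᶠ α in F, U α p < c := by
    exact (tendsto_id.prodMk (tendsto_const_pure.mono_right (pure_le_nhdsWithin hp))).eventually
      (p := fun q : ℝ × (ℝ × Space d) => U q.1 q.2 < c) h1
  obtain ⟨α, ha, hb⟩ := (h.and h2).exists
  exact absurd hb (not_lt.2 ha)

lemma abs_relaxedSup_le [F.NeBot] (hp : p ∈ QTbar d T) : |relaxedSup T F U p| ≤ M := by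
  rw [abs_le]
  exact ⟨le_relaxedSup hM hp (hM.mono fun α h => (abs_le.1 (h p hp)).1),
    relaxedSup_le hM hp ((eventually_abs_le hM p).mono fun _ hq => (abs_le.1 hq).2)⟩

lemma upperSemicontinuousOn_relaxedSup [F.NeBot] :
    UpperSemicontinuousOn (relaxedSup T F U) (QTbar d T) := by
  intro p hp c hc
  obtain ⟨c', h1, h2⟩ := exists_between hc
  obtain ⟨pa, hpa, pb, hpb, h⟩ := eventually_prod_iff.1 (eventually_lt_of_relaxedSup_lt hM h1)
  filter_upwards [eventually_eventually_nhdsWithin.2 hpb, self_mem_nhdsWithin] with q hq hq2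
  refine lt_of_le_of_lt (relaxedSup_le hM hq2 ?_) h2
  filter_upwards [hpa.prod_mk hq] with z hz
  exact (h hz.1 hz.2).le

lemma latticePeriodic_relaxedSup [F.NeBot]
    (hper : ∀ᶠ α in F, ∀ t ∈ Icc 0 T, LatticePeriodic fun x => U α (t, x)) {t : ℝ}
    (ht : t ∈ Icc 0 T) : LatticePeriodic fun x => relaxedSup T F U (t, x) := by
  have key : ∀ (x : Space d) (z : Fin d → ℤ),
      relaxedSup T F U (t, x + latticeVec z) ≤ relaxedSup T F U (t, x) := by
    intro x z
    refine le_of_forall_gt_imp_ge_of_dense fun c hc => ?_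
    obtain ⟨pa, hpa, pb, hpb, h⟩ := eventually_prod_iff.1 (eventually_lt_of_relaxedSup_lt hM hc)
    refine relaxedSup_le hM (mem_QTbar.2 ht) ?_
    have hmap : Tendsto (fun q : ℝ × Space d => (q.1, q.2 - latticeVec z))
        (𝓝[QTbar d T] (t, x + latticeVec z)) (𝓝[QTbar d T] (t, x)) := by
      have hc : ContinuousWithinAt (fun q : ℝ × Space d => (q.1, q.2 - latticeVec z)) (QTbar d T)
          (t, x + latticeVec z) := by fun_prop
      have := hc.tendsto_nhdsWithin (t := QTbar d T) (fun q hq => ⟨hq.1, mem_univ _⟩)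
      simpa using this
    filter_upwards [(hpa.and hper).prod_mk ((hmap.eventually hpb).and self_mem_nhdsWithin)]
      with q hq
    have h1 := h hq.1.1 hq.2.1
    have h2 : U q.1 (q.2.1, q.2.2 - latticeVec z + latticeVec z) =
      U q.1 (q.2.1, q.2.2 - latticeVec z) := hq.1.2 q.2.1 hq.2.2.1 _ z
    rw [sub_add_cancel] at h2
    rw [← h2] at h1
    exact h1.le
  intro x z
  refine le_antisymm (key x z) ?_
  have h := key (x + latticeVec z) (-z)
  have h2 : x + latticeVec z + latticeVec (-z) = x := by
    ext i; simp [latticeVec]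
  rwa [h2] at h

lemma exists_seq_relaxedSup [F.NeBot] [F.IsCountablyGenerated] (hp : p ∈ QTbar d T) :
    ∃ (α : ℕ → ℝ) (q : ℕ → ℝ × Space d), Tendsto α atTop F ∧
      Tendsto q atTop (𝓝[QTbar d T] p) ∧
      Tendsto (fun n => U (α n) (q n)) atTop (𝓝 (relaxedSup T F U p)) := by
  set L := F ×ˢ 𝓝[QTbar d T] p with hL
  set f : ℝ × (ℝ × Space d) → ℝ := fun q => U q.1 q.2 with hf
  have hcl : (L ⊓ comap f (𝓝 (relaxedSup T F U p))).NeBot := by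
    rw [inf_comm, neBot_inf_comap_iff_map']
    refine mapClusterPt_iff_frequently.2 ?_
    intro s hs
    obtain ⟨a, b, hab, hsub⟩ := mem_nhds_iff_exists_Ioo_subset.1 hs
    have h1 : ∃ᶠ q in L, a < f q :=
      frequently_lt_of_lt_limsup (isCoboundedUnder_relaxed hM hp) hab.1
    exact (h1.and_eventually (eventually_lt_of_relaxedSup_lt hM hab.2)).mono
      fun q hq => hsub ⟨hq.1, hq.2⟩
  obtain ⟨s, hs⟩ := exists_seq_tendsto (L ⊓ comap f (𝓝 (relaxedSup T F U p)))
  rw [tendsto_inf, tendsto_comap_iff, hL, tendsto_prod_iff'] at hs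
  exact ⟨fun n => (s n).1, fun n => (s n).2, hs.1.1, hs.1.2, hs.2⟩

/-- Maximum points of `U α - φ` converge to a strict maximum point of the relaxed limit. -/
lemma exists_seq_isMaxOn [F.NeBot] [F.IsCountablyGenerated] (hp : p ∈ QTbar d T)
    (hU : ∀ᶠ α in F, UpperSemicontinuousOn (U α) (QTbar d T)) {N : Set (ℝ × Space d)}
    (hN : IsCompact N) (hNsub : N ⊆ QTbar d T) (hNp : N ∈ 𝓝[QTbar d T] p)
    {φ : ℝ × Space d → ℝ} (hφ : ContinuousOn φ (QTbar d T))
    (hmax : ∀ q ∈ N, q ≠ p → relaxedSup T F U q - φ q < relaxedSup T F U p - φ p) :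
    ∃ (α : ℕ → ℝ) (q : ℕ → ℝ × Space d), Tendsto α atTop F ∧ (∀ n, q n ∈ N) ∧
      Tendsto q atTop (𝓝 p) ∧ Tendsto (fun n => U (α n) (q n)) atTop (𝓝 (relaxedSup T F U p)) ∧
      ∀ n, IsMaxOn (fun z => U (α n) z - φ z) N (q n) := by
  obtain ⟨α, q, hα, hq, hUq⟩ := exists_seq_relaxedSup hM hp
  obtain ⟨θ, hθ, hθ2⟩ := extraction_of_eventually_atTop ((hα.eventually hU).and (hq.eventually hNp))
  have hex : ∀ n, ∃ z ∈ N, IsMaxOn (fun z => U (α (θ n)) z - φ z) N z := fun n => by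
    have husc : UpperSemicontinuousOn (fun z => U (α (θ n)) z + -φ z) N :=
      ((hθ2 n).1.mono hNsub).add (hφ.neg.mono hNsub).upperSemicontinuousOn
    obtain ⟨z, hz, hzm⟩ := husc.exists_isMaxOn ⟨_, (hθ2 n).2⟩ hN
    exact ⟨z, hz, by simpa only [sub_eq_add_neg] using hzm⟩
  choose P hPN hPmax using hex
  obtain ⟨p', hp'N, ψ, hψ, hPψ⟩ := hN.tendsto_subseq hPN
  have hα' : Tendsto (fun n => α (θ (ψ n))) atTop F :=
    hα.comp (hθ.tendsto_atTop.comp hψ.tendsto_atTop)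
  have hq' : Tendsto (fun n => q (θ (ψ n))) atTop (𝓝[QTbar d T] p) :=
    hq.comp (hθ.tendsto_atTop.comp hψ.tendsto_atTop)
  have hUq' : Tendsto (fun n => U (α (θ (ψ n))) (q (θ (ψ n)))) atTop (𝓝 (relaxedSup T F U p)) :=
    hUq.comp (hθ.tendsto_atTop.comp hψ.tendsto_atTop)
  have hPw : Tendsto (fun n => P (ψ n)) atTop (𝓝[QTbar d T] p') :=
    tendsto_nhdsWithin_iff.2 ⟨hPψ, Eventually.of_forall fun n => hNsub (hPN _)⟩
  have hφP : Tendsto (fun n => φ (P (ψ n))) atTop (𝓝 (φ p')) :=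
    (hφ p' (hNsub hp'N)).tendsto.comp hPw
  have hφq : Tendsto (fun n => φ (q (θ (ψ n)))) atTop (𝓝 (φ p)) := (hφ p hp).tendsto.comp hq'
  have hlow : Tendsto (fun n => U (α (θ (ψ n))) (q (θ (ψ n))) - φ (q (θ (ψ n))) + φ (P (ψ n))) atTop
      (𝓝 (relaxedSup T F U p - φ p + φ p')) := (hUq'.sub hφq).add hφP
  have hle : ∀ n, U (α (θ (ψ n))) (q (θ (ψ n))) - φ (q (θ (ψ n))) + φ (P (ψ n)) ≤
      U (α (θ (ψ n))) (P (ψ n)) := fun n => by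
    have := hPmax (ψ n) (hθ2 (ψ n)).2
    simp only [mem_ofPred_eq] at this
    linarith
  have hup : ∀ c, relaxedSup T F U p' < c → ∀ᶠ n in atTop, U (α (θ (ψ n))) (P (ψ n)) < c :=
    fun c hc => (hα'.prodMk hPw).eventually (eventually_lt_of_relaxedSup_lt hM hc)
  have hpp : p' = p := by
    by_contra hne
    have h1 := hmax p' hp'N hne
    have h2 : relaxedSup T F U p - φ p + φ p' ≤ relaxedSup T F U p' := by
      refine le_of_forall_gt_imp_ge_of_dense fun c hc => ?_
      exact le_of_tendsto hlow ((hup c hc).mono fun n hn => (hle n).trans hn.le)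
    linarith
  subst hpp
  refine ⟨fun n => α (θ (ψ n)), fun n => P (ψ n), hα', fun n => hPN _, hPψ, ?_, fun n => hPmax _⟩
  rw [sub_add_cancel] at hlow
  rw [tendsto_order]
  exact ⟨fun c hc => (hlow.eventually (lt_mem_nhds hc)).mono fun n hn => hn.trans_le (hle n), hup⟩

end RelaxedSup

lemma IsHamiltonian.tendsto {H : ℝ → Space d → ℝ → Space d → ℝ} (hH : IsHamiltonian T H)
    {ι : Type*} {l : Filter ι} {t : ι → ℝ} {x p : ι → Space d} {r : ι → ℝ} {t₀ r₀ : ℝ}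
    {x₀ p₀ : Space d} (ht : Tendsto t l (𝓝 t₀)) (hx : Tendsto x l (𝓝 x₀))
    (hr : Tendsto r l (𝓝 r₀)) (hp : Tendsto p l (𝓝 p₀)) (htm : ∀ i, t i ∈ Icc 0 T)
    (ht₀ : t₀ ∈ Icc 0 T) :
    Tendsto (fun i => H (t i) (x i) (r i) (p i)) l (𝓝 (H t₀ x₀ r₀ p₀)) := by
  have h := hH.continuousOn (t₀, x₀, r₀, p₀) ⟨ht₀, mem_univ _⟩
  have h2 : Tendsto (fun i => (t i, x i, r i, p i)) l
      (𝓝[Icc 0 T ×ˢ univ] (t₀, x₀, r₀, p₀)) :=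
    tendsto_nhdsWithin_iff.2 ⟨ht.prodMk_nhds (hx.prodMk_nhds (hr.prodMk_nhds hp)),
      Eventually.of_forall fun i => ⟨htm i, mem_univ _⟩⟩
  exact h.tendsto.comp h2

/-- A bounded family of continuous subsolutions of orders in `(0,1)` with common initial data. -/
structure IsSubFamily (T β : ℝ) (H : ℝ → Space d → ℝ → Space d → ℝ) (u₀ : Space d → ℝ)
    (U : ℝ → ℝ × Space d → ℝ) (M : ℝ) : Prop where
  order : β ∈ Ioc (0 : ℝ) 1
  ham : IsHamiltonian T H
  sub : ∀ α ∈ Ioo (0 : ℝ) 1, IsFracSubsolution T α H (U α)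
  init : ∀ α ∈ Ioo (0 : ℝ) 1, ∀ x, U α (0, x) = u₀ x
  cont : Continuous u₀
  bound : ∀ᶠ α in 𝓝[Ioo (0 : ℝ) 1] β, ∀ p ∈ QTbar d T, |U α p| ≤ M

lemma neBot_orders {β : ℝ} (hβ : β ∈ Ioc (0 : ℝ) 1) : (𝓝[Ioo (0 : ℝ) 1] β).NeBot := by
  rw [← mem_closure_iff_nhdsWithin_neBot, closure_Ioo one_ne_zero.symm]
  exact Ioc_subset_Icc_self hβ

namespace IsSubFamily

variable {β M : ℝ} {H : ℝ → Space d → ℝ → Space d → ℝ} {u₀ : Space d → ℝ}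
  {U : ℝ → ℝ × Space d → ℝ} (hF : IsSubFamily T β H u₀ U M)
include hF

lemma relaxedSup_test
    (hinit : ∀ x, relaxedSup T (𝓝[Ioo (0 : ℝ) 1] β) U (0, x) = u₀ x)
    {φ : ℝ × Space d → ℝ} (hφ : IsTestFunction T φ) {a b ρ t₀ ε : ℝ} {x₀ : Space d}
    (ha : a ∈ Icc 0 T) (hb : b ∈ Icc 0 T) (hρ : 0 < ρ) (ht₀ : t₀ ∈ Ioc a b)
    (hN : Icc a b ×ˢ Metric.closedBall x₀ ρ ∈ 𝓝[QTbar d T] (t₀, x₀))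
    (hmax : ∀ q ∈ Icc a b ×ˢ Metric.closedBall x₀ ρ, q ≠ (t₀, x₀) →
      relaxedSup T (𝓝[Ioo (0 : ℝ) 1] β) U q - φ q <
        relaxedSup T (𝓝[Ioo (0 : ℝ) 1] β) U (t₀, x₀) - φ (t₀, x₀)) (hε : 0 < ε) :
    ∀ᶠ r in 𝓝[>] (0 : ℝ), K β r (relaxedSup T (𝓝[Ioo (0 : ℝ) 1] β) U) t₀ x₀ +
      H t₀ x₀ (relaxedSup T (𝓝[Ioo (0 : ℝ) 1] β) U (t₀, x₀)) (spaceGrad φ t₀ x₀) ≤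
      -((timeDeriv T φ t₀ x₀ - ε) * gcoef β * r ^ (1 - β)) := by
  have hne := neBot_orders hF.order
  set F := 𝓝[Ioo (0 : ℝ) 1] β with hFdef
  set v := relaxedSup T F U with hv
  have ht₀T : t₀ ∈ Ioc 0 T := ⟨ha.1.trans_lt ht₀.1, ht₀.2.trans hb.2⟩
  have hp : (t₀, x₀) ∈ QTbar d T := mem_QTbar.2 (Ioc_subset_Icc_self ht₀T)
  have hNsub : Icc a b ×ˢ Metric.closedBall x₀ ρ ⊆ QTbar d T :=
    prod_mono (Icc_subset_Icc ha.1 hb.2) (subset_univ _)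
  have hFI : ∀ᶠ α in F, α ∈ Ioo (0 : ℝ) 1 := self_mem_nhdsWithin
  obtain ⟨α', q', hα', hq'N, hq', hval', hmax'⟩ := exists_seq_isMaxOn hF.bound hp
    (hFI.mono fun α h => (hF.sub α h).1) (isCompact_Icc.prod (isCompact_closedBall x₀ ρ)) hNsub hN
    hφ.2.1 hmax
  obtain ⟨θ, hθ, hθ2⟩ := extraction_of_eventually_atTop
    ((hα'.eventually hFI).and (hα'.eventually hF.bound))
  set α : ℕ → ℝ := fun n => α' (θ n) with hαdef
  set q : ℕ → ℝ × Space d := fun n => q' (θ n) with hqdef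
  have hαF : Tendsto α atTop F := hα'.comp hθ.tendsto_atTop
  have hα : Tendsto α atTop (𝓝 β) := hαF.mono_right nhdsWithin_le_nhds
  have hqN : ∀ n, q n ∈ Icc a b ×ˢ Metric.closedBall x₀ ρ := fun n => hq'N _
  have hq : Tendsto q atTop (𝓝 (t₀, x₀)) := hq'.comp hθ.tendsto_atTop
  have hval : Tendsto (fun n => U (α n) (q n)) atTop (𝓝 (v (t₀, x₀))) := hval'.comp hθ.tendsto_atTop
  have ht : Tendsto (fun n => (q n).1) atTop (𝓝 t₀) := (continuous_fst.tendsto _).comp hq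
  have hx : Tendsto (fun n => (q n).2) atTop (𝓝 x₀) := (continuous_snd.tendsto _).comp hq
  have htm : ∀ n, (q n).1 ∈ Icc 0 T := fun n => (hNsub (hqN n)).1
  obtain ⟨δ, hδ, hinc⟩ := exists_time_increment hφ.1 ht₀T x₀ hε
  have hr0 : 0 < min δ ((t₀ - a) / 2) := lt_min hδ (by linarith [ht₀.1])
  filter_upwards [Ioo_mem_nhdsGT hr0] with r hr
  have hrδ : r < δ := hr.2.trans_le (min_le_left _ _)
  have hra : r < (t₀ - a) / 2 := hr.2.trans_le (min_le_right _ _)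
  have hev : ∀ᶠ n in atTop, K (α n) r (U (α n)) (q n).1 (q n).2 +
      H (q n).1 (q n).2 (U (α n) (q n)) (spaceGrad φ (q n).1 (q n).2) ≤
      -((timeDeriv T φ t₀ x₀ - ε) * gcoef (α n) * r ^ (1 - α n)) := by
    have e1 : ∀ᶠ n in atTop, |(q n).1 - t₀| < min δ ((t₀ - a) / 2) := by
      have := ht.eventually (Metric.ball_mem_nhds t₀ hr0)
      simpa only [Metric.mem_ball, Real.dist_eq] using this
    have e2 : ∀ᶠ n in atTop, dist (q n).2 x₀ < min δ ρ :=
      hx.eventually (Metric.ball_mem_nhds x₀ (lt_min hδ hρ))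
    filter_upwards [e1, e2] with n h1 h2
    have h1δ := h1.trans_le (min_le_left _ _)
    have h1a := abs_lt.1 (h1.trans_le (min_le_right _ _))
    have htn : (q n).1 ∈ Ioc 0 T := ⟨by linarith [ha.1, h1a.1, ht₀.1], (htm n).2⟩
    have hb1 : ∀ τ ∈ Ioc 0 r, _ := fun τ (hτ : τ ∈ Ioc 0 r) => abs_le.1 (hinc (q n).1 htn (q n).2
      h1δ (h2.trans_le (min_le_left _ _)) τ ⟨hτ.1.le, hτ.2.trans hrδ.le⟩)
    exact (hF.sub (α n) (hθ2 n).1).K_add_le (C := timeDeriv T φ t₀ x₀ + ε) (hθ2 n).1.1 (hθ2 n).1.2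
      ha hb hρ hφ ⟨by linarith [h1a.1], (hqN n).1.2⟩ (h2.trans_le (min_le_right _ _))
      (hmax' (θ n)) hr.1 (by linarith [h1a.1]) (fun τ hτ => by linarith [(hb1 τ hτ).1])
      (fun τ hτ => by linarith [(hb1 τ hτ).2])
  have hHlim : Tendsto (fun n => H (q n).1 (q n).2 (U (α n) (q n)) (spaceGrad φ (q n).1 (q n).2))
      atTop (𝓝 (H t₀ x₀ (v (t₀, x₀)) (spaceGrad φ t₀ x₀))) := by
    refine hF.ham.tendsto ht hx hval ?_ htm (Ioc_subset_Icc_self ht₀T)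
    have hc := continuousOn_spaceGrad hφ.1 (t₀, x₀) (mem_QT.2 ht₀T)
    refine hc.tendsto.comp (tendsto_nhdsWithin_iff.2 ⟨hq, ?_⟩)
    filter_upwards [ht.eventually (lt_mem_nhds ht₀T.1)] with n hn
    exact ⟨⟨hn, (htm n).2⟩, mem_univ _⟩
  have hRlim : Tendsto (fun n => -((timeDeriv T φ t₀ x₀ - ε) * gcoef (α n) * r ^ (1 - α n))) atTop
      (𝓝 (-((timeDeriv T φ t₀ x₀ - ε) * gcoef β * r ^ (1 - β)))) :=
    ((tendsto_const_nhds.mul ((continuous_gcoef.tendsto β).comp hα)).mul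
      (tendsto_const_nhds.rpow (tendsto_const_nhds.sub hα) (Or.inl hr.1.ne'))).neg
  rw [← le_sub_iff_add_le]
  refine le_of_forall_lt_imp_le_of_dense fun A hA => ?_
  have hK := eventually_lt_K (V := fun n => U (α n)) (t := fun n => (q n).1)
    (x := fun n => (q n).2) hF.order.1 hF.order.2 hα (fun n => (hθ2 n).1)
    (fun n => (hF.sub _ (hθ2 n).1).1) (upperSemicontinuousOn_relaxedSup hF.bound)
    (fun n => (hθ2 n).2) (fun p hp => abs_relaxedSup_le hF.bound hp) ht hx htm ht₀T hval
    (by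
      rw [show relaxedSup T F U (0, x₀) = u₀ x₀ from hinit x₀]
      refine ((hF.cont.tendsto x₀).comp hx).congr fun n => ?_
      exact (hF.init _ (hθ2 n).1 _).symm)
    (fun p hp z hz hz' c hc => (hαF.prodMk (tendsto_nhdsWithin_iff.2 ⟨hz', hz⟩)).eventually
      (eventually_lt_of_relaxedSup_lt hF.bound hc))
    (r := r) ⟨hr.1, by linarith [ha.1, ht₀.1]⟩ hA
  rw [le_sub_iff_add_le]
  refine le_of_tendsto_of_tendsto (hHlim.const_add A) hRlim ?_
  filter_upwards [hK, hev] with n h1 h2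
  linarith

end IsSubFamily

/-- The consequence of being a subsolution of order `β ∈ (0,1]` on which the comparison principle
rests. -/
def IsWeakSub (T β : ℝ) (H : ℝ → Space d → ℝ → Space d → ℝ) (u : ℝ × Space d → ℝ) : Prop :=
  ∀ φ : ℝ × Space d → ℝ, ContDiff ℝ 1 φ → ∀ t ∈ Ioc 0 T, ∀ x,
    (∀ p ∈ QTbar d T, u p - φ p ≤ u (t, x) - φ (t, x)) → ∀ ε > 0, ∀ᶠ r in 𝓝[>] (0 : ℝ),
      K β r u t x + H t x (u (t, x)) (spaceGrad φ t x) ≤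
        -((timeDeriv T φ t x - ε) * gcoef β * r ^ (1 - β))

lemma IsFracSubsolution.isWeakSub {α : ℝ} {H : ℝ → Space d → ℝ → Space d → ℝ}
    {u : ℝ × Space d → ℝ} (hα : α ∈ Ioo (0 : ℝ) 1) (hu : IsFracSubsolution T α H u) :
    IsWeakSub T α H u := by
  intro φ hφ t ht x hmax ε hε
  obtain ⟨δ, hδ, hinc⟩ := exists_time_increment (T := T) hφ.contDiffOn ht x hε
  have hT : 0 ≤ T := ht.1.le.trans ht.2
  filter_upwards [Ioo_mem_nhdsGT (lt_min hδ ht.1)] with r hr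
  have hb1 : ∀ τ ∈ Ioc 0 r, _ := fun τ (hτ : τ ∈ Ioc 0 r) => abs_le.1 (hinc t ht x
    (by simpa using hδ) (by simpa using hδ) τ
    ⟨hτ.1.le, hτ.2.trans (hr.2.le.trans (min_le_left _ _))⟩)
  exact hu.K_add_le (a := 0) (b := T) (c := x) (ρ := 1) (C := timeDeriv T φ t x + ε) hα.1 hα.2
    (left_mem_Icc.2 hT) (right_mem_Icc.2 hT) one_pos (isTestFunction_of_contDiff hφ) ht
    (Metric.mem_ball_self one_pos) (fun q hq => hmax q ⟨hq.1, mem_univ _⟩) hr.1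
    (by linarith [hr.2.trans_le (min_le_right δ t)]) (fun τ hτ => by linarith [(hb1 τ hτ).1])
    (fun τ hτ => by linarith [(hb1 τ hτ).2])

lemma K_one (r : ℝ) (f : ℝ × Space d → ℝ) (t : ℝ) (x : Space d) : K 1 r f t x = 0 := by
  simp [K, Real.Gamma_zero]

lemma gcoef_one : gcoef 1 = 1 := by
  norm_num [gcoef, Real.Gamma_one]

lemma IsFirstOrderSubsolution.isWeakSub {H : ℝ → Space d → ℝ → Space d → ℝ}
    {u : ℝ × Space d → ℝ} (hu : IsFirstOrderSubsolution T H u) : IsWeakSub T 1 H u := by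
  intro φ hφ t ht x hmax ε hε
  have h := hu.2.2 φ t x hφ.contDiffOn ht (by
    filter_upwards [self_mem_nhdsWithin] with p hp
    exact hmax p (QT_subset_QTbar hp))
  refine Eventually.of_forall fun r => ?_
  rw [K_one, gcoef_one, sub_self, Real.rpow_zero]
  linarith

lemma spaceGrad_quadratic (A B η c : ℝ) (y : Space d) (t : ℝ) (x : Space d) :
    spaceGrad (fun p : ℝ × Space d => A * ‖p.2 - y‖ ^ 2 + (B * (p.1 - c) ^ 2 + η * p.1)) t x =
      (2 * A) • (x - y) :=
  gradient_quadratic A (B * (t - c) ^ 2 + η * t) y x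

lemma timeDeriv_quadratic (A B η c : ℝ) (y : Space d) {t : ℝ} (ht : t ∈ Ioc 0 T) (x : Space d) :
    timeDeriv T (fun p : ℝ × Space d => A * ‖p.2 - y‖ ^ 2 + (B * (p.1 - c) ^ 2 + η * p.1)) t x =
      2 * B * (t - c) + η := by
  have h : HasDerivAt (fun s : ℝ => A * ‖x - y‖ ^ 2 + (B * (s - c) ^ 2 + η * s))
      (B * (2 * (t - c)) + η * 1) t := by
    have h1 : HasDerivAt (fun s : ℝ => (s - c) ^ 2) (2 * (t - c)) t := by
      simpa using ((hasDerivAt_id t).sub_const c).fun_pow 2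
    exact ((h1.const_mul B).add ((hasDerivAt_id t).const_mul η)).const_add _
  rw [timeDeriv, h.hasDerivWithinAt.derivWithin (uniqueDiffOn_Ioc 0 T t ht)]
  ring

lemma contDiff_spaceTimeQuadratic (A B η c : ℝ) (y : Space d) :
    ContDiff ℝ 1 fun p : ℝ × Space d => A * ‖p.2 - y‖ ^ 2 + (B * (p.1 - c) ^ 2 + η * p.1) := by
  refine (contDiff_const.mul ((contDiff_snd.sub contDiff_const).norm_sq ℝ)).add ?_
  fun_prop

lemma IsSubFamily.isWeakSub_relaxedSup {β M : ℝ} {H : ℝ → Space d → ℝ → Space d → ℝ}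
    {u₀ : Space d → ℝ} {U : ℝ → ℝ × Space d → ℝ} (hF : IsSubFamily T β H u₀ U M)
    (hinit : ∀ x, relaxedSup T (𝓝[Ioo (0 : ℝ) 1] β) U (0, x) = u₀ x) :
    IsWeakSub T β H (relaxedSup T (𝓝[Ioo (0 : ℝ) 1] β) U) := by
  intro φ hφ t ht x hmax ε hε
  set ψ : ℝ × Space d → ℝ := fun p => 1 * ‖p.2 - x‖ ^ 2 + (1 * (p.1 - t) ^ 2 + 0 * p.1) with hψdef
  have hψ : ContDiff ℝ 1 ψ := contDiff_spaceTimeQuadratic 1 1 0 t x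
  have hT : 0 ≤ T := ht.1.le.trans ht.2
  have h := hF.relaxedSup_test hinit (isTestFunction_of_contDiff (hφ.add hψ)) (a := 0) (b := T)
    (ρ := 1) (x₀ := x) (left_mem_Icc.2 hT) (right_mem_Icc.2 hT) one_pos ht
    (by
      have : ∀ᶠ q : ℝ × Space d in 𝓝[QTbar d T] (t, x), q.2 ∈ Metric.closedBall x 1 :=
        ((continuous_snd.tendsto (t, x)).eventually
          (Metric.closedBall_mem_nhds x one_pos)).filter_mono nhdsWithin_le_nhds
      filter_upwards [this, self_mem_nhdsWithin] with q h1 h2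
      exact ⟨h2.1, h1⟩)
    (by
      intro q hq hne
      have h1 := hmax q ⟨hq.1, mem_univ _⟩
      have h2 : 0 < ψ q := by
        simp only [hψdef, one_mul, zero_mul, add_zero]
        by_contra! hle
        have h3 := sq_nonneg ‖q.2 - x‖
        have h4 := sq_nonneg (q.1 - t)
        have h5 : ‖q.2 - x‖ ^ 2 = 0 := by linarith
        have h6 : (q.1 - t) ^ 2 = 0 := by linarith
        rw [sq_eq_zero_iff, norm_eq_zero, sub_eq_zero] at h5
        rw [sq_eq_zero_iff, sub_eq_zero] at h6
        exact hne (Prod.ext h6 h5)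
      have h7 : ψ (t, x) = 0 := by simp [hψdef]
      rw [h7]
      linarith) hε
  rw [spaceGrad_add hφ.contDiffOn hψ.contDiffOn ht, timeDeriv_add hφ.contDiffOn hψ.contDiffOn ht,
    spaceGrad_quadratic, timeDeriv_quadratic _ _ _ _ _ ht] at h
  simpa using h

section Comparison

variable {β M : ℝ} {H : ℝ → Space d → ℝ → Space d → ℝ} {u₀ : Space d → ℝ}
  {u w : ℝ × Space d → ℝ}

/-- The doubled functional. -/
noncomputable def doubled (u w : ℝ × Space d → ℝ) (A B η : ℝ) (p q : ℝ × Space d) : ℝ :=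
  u p + w q - A * ‖p.2 - q.2‖ ^ 2 - B * (p.1 - q.1) ^ 2 - η * p.1

lemma neg_le_integral_truncDiff_add {A B η r t s : ℝ} {x y : Space d} (hβ : β ∈ Ioc (0 : ℝ) 1)
    (hu : UpperSemicontinuousOn u (QTbar d T)) (hw : UpperSemicontinuousOn w (QTbar d T))
    (huM : ∀ p ∈ QTbar d T, |u p| ≤ M) (hwM : ∀ p ∈ QTbar d T, |w p| ≤ M) (hη : 0 ≤ η)
    (hr : 0 < r) (ht : t ∈ Ioc 0 T) (hs : s ∈ Ioc 0 T)
    (hmax : ∀ p ∈ QTbar d T, ∀ q ∈ QTbar d T,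
      doubled u w A B η p q ≤ doubled u w A B η (t, x) (s, y)) :
    -(4 * M / min (min t s) 1 ^ 2 * |t - s|) ≤
      (∫ τ in Ioc r T, truncDiff β u t x τ) + ∫ τ in Ioc r T, truncDiff β w s y τ := by
  have ht' := Ioc_subset_Icc_self ht
  have hs' := Ioc_subset_Icc_self hs
  have hM0 : 0 ≤ M := (abs_nonneg _).trans (huM (t, x) (mem_QTbar.2 ht'))
  set c := 4 * M / min (min t s) 1 ^ 2 with hc
  have hc0 : 0 ≤ c := by positivity
  have hiu : IntegrableOn (truncDiff β u t x) (Ioc r T) :=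
    integrableOn_truncDiff hβ.1 hβ.2 hr ht' hu huM
  have hiw : IntegrableOn (truncDiff β w s y) (Ioc r T) :=
    integrableOn_truncDiff hβ.1 hβ.2 hr hs' hw hwM
  have hmin : 0 < min t s := lt_min ht.1 hs.1
  have hpt : ∀ τ ∈ Ioc r T, (Ioc (min t s) (max t s)).indicator (fun _ => -c) τ ≤
      truncDiff β u t x τ + truncDiff β w s y τ := by
    intro τ hτ
    have hτ0 : 0 < τ := hr.trans hτ.1
    rcases le_or_gt τ (min t s) with h | h
    · rw [indicator_of_notMem (fun h' => absurd h'.1 (not_lt.2 h))]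
      have h1 := h.trans (min_le_left _ _)
      have h2 := h.trans (min_le_right _ _)
      rw [truncDiff_of_le h1, truncDiff_of_le h2, ← add_div]
      refine div_nonneg ?_ (Real.rpow_nonneg hτ0.le _)
      have := hmax (t - τ, x) (mem_QTbar.2 ⟨by linarith, by linarith [ht.2]⟩)
        (s - τ, y) (mem_QTbar.2 ⟨by linarith, by linarith [hs.2]⟩)
      simp only [doubled, sub_sub_sub_cancel_right] at this
      nlinarith [mul_nonneg hη hτ0.le]
    · rcases le_or_gt τ (max t s) with h' | h'
      · rw [indicator_of_mem (show τ ∈ Ioc (min t s) (max t s) from ⟨h, h'⟩)]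
        have h1 := abs_le.1 (abs_truncDiff_le (x := x) hβ.1 hβ.2 hmin h.le ht' huM)
        have h2 := abs_le.1 (abs_truncDiff_le (x := y) hβ.1 hβ.2 hmin h.le hs' hwM)
        have h3 : c = 2 * M / min (min t s) 1 ^ 2 + 2 * M / min (min t s) 1 ^ 2 := by
          rw [hc]; ring
        linarith
      · rw [indicator_of_notMem (fun h'' => absurd h''.2 (not_le.2 h')),
          truncDiff_of_lt ((le_max_left _ _).trans_lt h'),
          truncDiff_of_lt ((le_max_right _ _).trans_lt h'), add_zero]
  have hind : IntegrableOn ((Ioc (min t s) (max t s)).indicator (fun _ => -c)) (Ioc r T) :=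
    (integrableOn_const (by simp)).indicator measurableSet_Ioc
  rw [← integral_add hiu hiw]
  refine le_trans ?_ (setIntegral_mono_on hind (hiu.add hiw) measurableSet_Ioc hpt)
  rw [setIntegral_indicator measurableSet_Ioc, setIntegral_const, smul_eq_mul]
  have hvol : volume.real (Ioc r T ∩ Ioc (min t s) (max t s)) ≤ |t - s| := by
    refine (measureReal_mono inter_subset_right (by simp)).trans (le_of_eq ?_)
    rw [Real.volume_real_Ioc_of_le min_le_max, max_sub_min_eq_abs, abs_sub_comm]
  nlinarith

/-- The inequality obtained at a maximum point of the doubled functional. -/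
lemma doubled_inequality {A B η t s : ℝ} {x y : Space d} (hβ : β ∈ Ioc (0 : ℝ) 1)
    (hus : IsWeakSub T β H u) (hws : IsWeakSub T β (negHam H) w)
    (hu : UpperSemicontinuousOn u (QTbar d T)) (hw : UpperSemicontinuousOn w (QTbar d T))
    (huM : ∀ p ∈ QTbar d T, |u p| ≤ M) (hwM : ∀ p ∈ QTbar d T, |w p| ≤ M) (hη : 0 ≤ η)
    (ht : t ∈ Ioc 0 T) (hs : s ∈ Ioc 0 T)
    (hmax : ∀ p ∈ QTbar d T, ∀ q ∈ QTbar d T,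
      doubled u w A B η p q ≤ doubled u w A B η (t, x) (s, y)) :
    (u (t, x) - u (0, x)) * ((t ^ β)⁻¹ * (Real.Gamma (1 - β))⁻¹) +
      (w (s, y) - w (0, y)) * ((s ^ β)⁻¹ * (Real.Gamma (1 - β))⁻¹) -
      β * (Real.Gamma (1 - β))⁻¹ * (4 * M / min (min t s) 1 ^ 2 * |t - s|) +
      (H t x (u (t, x)) ((2 * A) • (x - y)) - H s y (-w (s, y)) ((2 * A) • (x - y))) ≤
      -(η * gcoef β * 0 ^ (1 - β)) := by
  set X := (u (t, x) - u (0, x)) * ((t ^ β)⁻¹ * (Real.Gamma (1 - β))⁻¹) +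
      (w (s, y) - w (0, y)) * ((s ^ β)⁻¹ * (Real.Gamma (1 - β))⁻¹) -
      β * (Real.Gamma (1 - β))⁻¹ * (4 * M / min (min t s) 1 ^ 2 * |t - s|) +
      (H t x (u (t, x)) ((2 * A) • (x - y)) - H s y (-w (s, y)) ((2 * A) • (x - y))) with hX
  have ht' := Ioc_subset_Icc_self ht
  have hs' := Ioc_subset_Icc_self hs
  have hcΓ : 0 ≤ β * (Real.Gamma (1 - β))⁻¹ :=
    mul_nonneg hβ.1.le (inv_nonneg.2 (Real.Gamma_nonneg_of_nonneg (by linarith [hβ.2])))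
  have key : ∀ ε > 0, X ≤ -((η - 2 * ε) * gcoef β * 0 ^ (1 - β)) := by
    intro ε hε
    have h1 := hus _ (contDiff_spaceTimeQuadratic A B η s y) t ht x (by
      intro p hp
      have := hmax p hp (s, y) (mem_QTbar.2 hs')
      simp only [doubled] at this ⊢
      linarith) ε hε
    have h2 := hws _ (contDiff_spaceTimeQuadratic A B 0 t x) s hs y (by
      intro p hp
      have := hmax (t, x) (mem_QTbar.2 ht') p hp
      simp only [doubled] at this ⊢
      rw [norm_sub_rev x p.2, norm_sub_rev x y] at this
      nlinarith) ε hε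
    simp only [spaceGrad_quadratic] at h1 h2
    rw [timeDeriv_quadratic _ _ _ _ _ ht] at h1
    rw [timeDeriv_quadratic _ _ _ _ _ hs] at h2
    have hlim : Tendsto (fun r : ℝ => -((η - 2 * ε) * gcoef β * r ^ (1 - β))) (𝓝[>] 0)
        (𝓝 (-((η - 2 * ε) * gcoef β * 0 ^ (1 - β)))) :=
      (((Real.continuousAt_rpow_const 0 (1 - β) (Or.inr (by linarith [hβ.2]))).tendsto.mono_left
        nhdsWithin_le_nhds).const_mul _).neg
    refine ge_of_tendsto hlim ?_
    filter_upwards [h1, h2, Ioo_mem_nhdsGT (lt_min ht.1 hs.1)] with r e1 e2 hr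
    have h3 := neg_le_integral_truncDiff_add hβ hu hw huM hwM hη hr.1 ht hs hmax
    have h4 := mul_le_mul_of_nonneg_left h3 hcΓ
    rw [K, integral_kernelDiff_eq (hr.2.le.trans (min_le_left _ _)) ht.2, div_eq_mul_inv, mul_inv,
      div_eq_mul_inv] at e1
    rw [K, integral_kernelDiff_eq (hr.2.le.trans (min_le_right _ _)) hs.2, div_eq_mul_inv, mul_inv,
      div_eq_mul_inv] at e2
    have h5 : -((2 * A) • (y - x)) = (2 * A) • (x - y) := by rw [← smul_neg, neg_sub]
    simp only [negHam, h5] at e2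
    have h6 : (2 * B * (t - s) + η - ε) * gcoef β * r ^ (1 - β) +
      (2 * B * (s - t) + 0 - ε) * gcoef β * r ^ (1 - β) = (η - 2 * ε) * gcoef β * r ^ (1 - β) := by
      ring
    rw [hX, ← h6]
    linarith
  have hlim : Tendsto (fun ε : ℝ => -((η - 2 * ε) * gcoef β * 0 ^ (1 - β))) (𝓝[>] 0)
      (𝓝 (-((η - 2 * 0) * gcoef β * 0 ^ (1 - β)))) := by
    have : Continuous fun ε : ℝ => -((η - 2 * ε) * gcoef β * 0 ^ (1 - β)) := by fun_prop
    exact (this.tendsto 0).mono_left nhdsWithin_le_nhds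
  have := ge_of_tendsto hlim (eventually_mem_nhdsWithin.mono fun ε hε => key ε hε)
  simpa using this

lemma exists_isMax_doubled (hT : 0 < T) {η : ℝ} (hη : 0 ≤ η)
    (hu : UpperSemicontinuousOn u (QTbar d T)) (hw : UpperSemicontinuousOn w (QTbar d T))
    (huM : ∀ p ∈ QTbar d T, |u p| ≤ M) (hwM : ∀ p ∈ QTbar d T, |w p| ≤ M)
    (hup : ∀ t ∈ Icc 0 T, LatticePeriodic fun x => u (t, x))
    (hwp : ∀ t ∈ Icc 0 T, LatticePeriodic fun x => w (t, x)) :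
    ∃ R > 0, ∀ A B : ℝ, 1 ≤ A → 0 ≤ B →
      ∃ p ∈ Icc 0 T ×ˢ Metric.closedBall (0 : Space d) R,
      ∃ q ∈ Icc 0 T ×ˢ Metric.closedBall (0 : Space d) R,
        ∀ p' ∈ QTbar d T, ∀ q' ∈ QTbar d T, doubled u w A B η p' q' ≤ doubled u w A B η p q := by
  obtain ⟨R₀, hR₀, hlat⟩ := exists_lattice_near d
  have h00 : ((0 : ℝ), (0 : Space d)) ∈ QTbar d T := mem_QTbar.2 (left_mem_Icc.2 hT.le)
  have hM0 : 0 ≤ M := (abs_nonneg _).trans (huM _ h00)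
  set L := 4 * M + 1 with hL
  refine ⟨R₀ + L, by positivity, fun A B hA hB => ?_⟩
  set N := Icc 0 T ×ˢ Metric.closedBall (0 : Space d) (R₀ + L) with hN
  have hNsub : N ⊆ QTbar d T := prod_mono subset_rfl (subset_univ _)
  have hNc : IsCompact N := isCompact_Icc.prod (isCompact_closedBall _ _)
  have h0N : ((0 : ℝ), (0 : Space d)) ∈ N :=
    mk_mem_prod (left_mem_Icc.2 hT.le) (Metric.mem_closedBall_self (by positivity))
  have hu1 : UpperSemicontinuousOn (fun z : (ℝ × Space d) × (ℝ × Space d) => u z.1) (N ×ˢ N) :=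
    fun z hz c hc => ((continuousWithinAt_fst (s := N ×ˢ N) (p := z)).tendsto_nhdsWithin
      (fun a ha => hNsub ha.1)).eventually (hu z.1 (hNsub hz.1) c hc)
  have hw1 : UpperSemicontinuousOn (fun z : (ℝ × Space d) × (ℝ × Space d) => w z.2) (N ×ˢ N) :=
    fun z hz c hc => ((continuousWithinAt_snd (s := N ×ˢ N) (p := z)).tendsto_nhdsWithin
      (fun a ha => hNsub ha.2)).eventually (hw z.2 (hNsub hz.2) c hc)
  have hc1 : Continuous fun z : (ℝ × Space d) × (ℝ × Space d) =>
      -(A * ‖z.1.2 - z.2.2‖ ^ 2 + B * (z.1.1 - z.2.1) ^ 2 + η * z.1.1) := by fun_prop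
  have husc := (hu1.add hw1).add hc1.continuousOn.upperSemicontinuousOn
  obtain ⟨⟨p, q⟩, hpq, hmax⟩ := husc.exists_isMaxOn ⟨_, mk_mem_prod h0N h0N⟩ (hNc.prod hNc)
  have hmax' : ∀ p' ∈ N, ∀ q' ∈ N, doubled u w A B η p' q' ≤ doubled u w A B η p q := by
    intro p' hp' q' hq'
    have := hmax (mk_mem_prod hp' hq')
    simp only [mem_ofPred_eq] at this
    simp only [doubled]
    linarith
  refine ⟨p, hpq.1, q, hpq.2, ?_⟩
  rintro ⟨t, x⟩ hp' ⟨s, y⟩ hq'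
  rw [mem_QTbar] at hp' hq'
  obtain ⟨z, hz⟩ := hlat x 0
  rw [sub_zero] at hz
  have hshift : doubled u w A B η (t, x) (s, y) =
      doubled u w A B η (t, x + latticeVec z) (s, y + latticeVec z) := by
    have h1 : u (t, x + latticeVec z) = u (t, x) := hup t hp' x z
    have h2 : w (s, y + latticeVec z) = w (s, y) := hwp s hq' y z
    simp only [doubled, h1, h2, add_sub_add_right_eq_sub]
  rw [hshift]
  by_cases hy : ‖y + latticeVec z‖ ≤ R₀ + L
  · exact hmax' _ (mk_mem_prod hp' (mem_closedBall_zero_iff.2 (by linarith)))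
      _ (mk_mem_prod hq' (mem_closedBall_zero_iff.2 hy))
  · refine le_trans ?_ (hmax' _ h0N _ h0N)
    have h1 : L ≤ ‖x + latticeVec z - (y + latticeVec z)‖ := by
      have := norm_sub_norm_le (y + latticeVec z) (x + latticeVec z)
      rw [norm_sub_rev] at this
      linarith [not_le.1 hy]
    have h2 : 4 * M ≤ A * ‖x + latticeVec z - (y + latticeVec z)‖ ^ 2 := by
      have h3 : L ^ 2 ≤ ‖x + latticeVec z - (y + latticeVec z)‖ ^ 2 := by gcongr
      nlinarith
    have h3 := (abs_le.1 (huM (t, x + latticeVec z) (mem_QTbar.2 hp'))).2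
    have h4 := (abs_le.1 (hwM (s, y + latticeVec z) (mem_QTbar.2 hq'))).2
    have h5 := (abs_le.1 (huM _ h00)).1
    have h6 := (abs_le.1 (hwM _ h00)).1
    have h7 : 0 ≤ B * (t - s) ^ 2 := by positivity
    have h8 : 0 ≤ η * t := mul_nonneg hη hp'.1
    have h9 : doubled u w A B η (0, 0) (0, 0) = u (0, 0) + w (0, 0) := by simp [doubled]
    rw [h9]
    simp only [doubled]
    linarith

end Comparison

lemma tendsto_of_eventually_lt_of_le_add {f g h : ℕ → ℝ} {a b : ℝ}
    (hf : ∀ c, a < c → ∀ᶠ n in atTop, f n < c) (hg : ∀ c, b < c → ∀ᶠ n in atTop, g n < c)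
    (hh : Tendsto h atTop (𝓝 (a + b))) (hle : ∀ n, h n ≤ f n + g n) :
    Tendsto f atTop (𝓝 a) := by
  rw [tendsto_order]
  refine ⟨fun c hc => ?_, hf⟩
  filter_upwards [hg (b + (a - c) / 2) (by linarith),
    hh.eventually (lt_mem_nhds (show a + b - (a - c) / 2 < a + b by linarith))] with n h1 h2
  linarith [hle n]

lemma uniformContinuous_of_latticePeriodic {f : Space d → ℝ} (hf : Continuous f)
    (hper : LatticePeriodic f) {ε : ℝ} (hε : 0 < ε) :
    ∃ δ > 0, ∀ x y, ‖x - y‖ < δ → |f x - f y| < ε := by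
  obtain ⟨R₀, hR₀, hlat⟩ := exists_lattice_near d
  have huc := (isCompact_closedBall (0 : Space d) (R₀ + 1)).uniformContinuousOn_of_continuous
    hf.continuousOn
  obtain ⟨δ, hδ, h⟩ := Metric.uniformContinuousOn_iff.1 huc ε hε
  refine ⟨min δ 1, lt_min hδ one_pos, fun x y hxy => ?_⟩
  obtain ⟨z, hz⟩ := hlat x 0
  rw [sub_zero] at hz
  have h1 : ‖y + latticeVec z‖ ≤ R₀ + 1 := by
    have h2 := norm_sub_norm_le (y + latticeVec z) (x + latticeVec z)
    rw [add_sub_add_right_eq_sub, norm_sub_rev] at h2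
    linarith [hxy.trans_le (min_le_right δ 1)]
  have h3 := h (x + latticeVec z) (mem_closedBall_zero_iff.2 (by linarith)) (y + latticeVec z)
    (mem_closedBall_zero_iff.2 h1) (by
      rw [dist_add_right, dist_eq_norm]; exact hxy.trans_le (min_le_left _ _))
  rwa [hper x z, hper y z, Real.dist_eq] at h3

section Comparison

variable {β M : ℝ} {H : ℝ → Space d → ℝ → Space d → ℝ} {u₀ : Space d → ℝ}
  {u w : ℝ × Space d → ℝ}

/-- Letting the penalization of the time variables tend to infinity. -/
lemma exists_isMax_doubled_space (hβ : β ∈ Ioc (0 : ℝ) 1) (hT : 0 < T) (hH : IsHamiltonian T H)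
    (hus : IsWeakSub T β H u) (hws : IsWeakSub T β (negHam H) w)
    (hu : UpperSemicontinuousOn u (QTbar d T)) (hw : UpperSemicontinuousOn w (QTbar d T))
    (huM : ∀ p ∈ QTbar d T, |u p| ≤ M) (hwM : ∀ p ∈ QTbar d T, |w p| ≤ M)
    (hup : ∀ t ∈ Icc 0 T, LatticePeriodic fun x => u (t, x))
    (hwp : ∀ t ∈ Icc 0 T, LatticePeriodic fun x => w (t, x))
    (hu₀ : Continuous u₀) (hui : ∀ x, u (0, x) ≤ u₀ x) (hwi : ∀ x, w (0, x) ≤ -u₀ x)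
    {η : ℝ} (hη : 0 ≤ η) {A : ℝ} (hA : 1 ≤ A) :
    ∃ t ∈ Icc 0 T, ∃ x y : Space d,
      (∀ t' ∈ Icc 0 T, ∀ x' y' : Space d,
        doubled u w A 0 η (t', x') (t', y') ≤ doubled u w A 0 η (t, x) (t, y)) ∧
      (0 < t → (u (t, x) + w (t, y) - (u₀ x - u₀ y)) * ((t ^ β)⁻¹ * (Real.Gamma (1 - β))⁻¹) +
        (H t x (u (t, x)) ((2 * A) • (x - y)) - H t y (-w (t, y)) ((2 * A) • (x - y))) ≤
        -(η * gcoef β * 0 ^ (1 - β))) := by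
  obtain ⟨R, hR, hmax⟩ := exists_isMax_doubled hT hη hu hw huM hwM hup hwp
  set N := Icc 0 T ×ˢ Metric.closedBall (0 : Space d) R with hN
  have hNsub : N ⊆ QTbar d T := prod_mono subset_rfl (subset_univ _)
  have hNc : IsCompact N := isCompact_Icc.prod (isCompact_closedBall _ _)
  choose P hPN Q hQN hPQ using fun n : ℕ => hmax A n hA n.cast_nonneg
  obtain ⟨⟨p, q⟩, hpq, θ, hθ, hlim⟩ := (hNc.prod hNc).tendsto_subseq
    (x := fun n => (P n, Q n)) (fun n => mk_mem_prod (hPN n) (hQN n))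
  have ha : Tendsto (fun n => P (θ n)) atTop (𝓝 p) := (continuous_fst.tendsto _).comp hlim
  have hb : Tendsto (fun n => Q (θ n)) atTop (𝓝 q) := (continuous_snd.tendsto _).comp hlim
  have hpT := hNsub hpq.1
  have hqT := hNsub hpq.2
  have haT : ∀ n, P (θ n) ∈ QTbar d T := fun n => hNsub (hPN _)
  have hbT : ∀ n, Q (θ n) ∈ QTbar d T := fun n => hNsub (hQN _)
  have ha1 : Tendsto (fun n => (P (θ n)).1) atTop (𝓝 p.1) := (continuous_fst.tendsto _).comp ha
  have hb1 : Tendsto (fun n => (Q (θ n)).1) atTop (𝓝 q.1) := (continuous_fst.tendsto _).comp hb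
  have ha2 : Tendsto (fun n => (P (θ n)).2) atTop (𝓝 p.2) := (continuous_snd.tendsto _).comp ha
  have hb2 : Tendsto (fun n => (Q (θ n)).2) atTop (𝓝 q.2) := (continuous_snd.tendsto _).comp hb
  have h00 : ((0 : ℝ), (0 : Space d)) ∈ QTbar d T := mem_QTbar.2 (left_mem_Icc.2 hT.le)
  have htime : p.1 = q.1 := by
    have hbd : ∀ n, (θ n : ℝ) * ((P (θ n)).1 - (Q (θ n)).1) ^ 2 ≤ 4 * M := fun n => by
      have h1 := hPQ (θ n) _ h00 _ h00
      have h2 : doubled u w A (θ n) η (0, 0) (0, 0) = u (0, 0) + w (0, 0) := by simp [doubled]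
      rw [h2] at h1
      simp only [doubled] at h1
      have h3 := (abs_le.1 (huM _ (haT n))).2
      have h4 := (abs_le.1 (hwM _ (hbT n))).2
      have h5 := (abs_le.1 (huM _ h00)).1
      have h6 := (abs_le.1 (hwM _ h00)).1
      have h7 : 0 ≤ A * ‖(P (θ n)).2 - (Q (θ n)).2‖ ^ 2 := by positivity
      have h8 : 0 ≤ η * (P (θ n)).1 := mul_nonneg hη (haT n).1.1
      linarith
    have hθinf : Tendsto (fun n => (θ n : ℝ)) atTop atTop :=
      tendsto_natCast_atTop_atTop.comp hθ.tendsto_atTop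
    have h0 : Tendsto (fun n => ((P (θ n)).1 - (Q (θ n)).1) ^ 2) atTop (𝓝 0) := by
      refine squeeze_zero' (Eventually.of_forall fun n => sq_nonneg _) ?_
        (hθinf.const_div_atTop (4 * M))
      filter_upwards [hθinf.eventually_gt_atTop 0] with n hn
      rw [le_div_iff₀ hn, mul_comm]
      exact hbd n
    have := tendsto_nhds_unique h0 ((ha1.sub hb1).pow 2)
    exact sub_eq_zero.1 (sq_eq_zero_iff.1 this.symm)
  obtain ⟨t, x⟩ := p
  obtain ⟨s, y⟩ := q
  simp only at htime ha1 hb1 ha2 hb2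
  subst htime
  rw [mem_QTbar] at hpT
  have haw : Tendsto (fun n => P (θ n)) atTop (𝓝[QTbar d T] (t, x)) :=
    tendsto_nhdsWithin_iff.2 ⟨ha, Eventually.of_forall haT⟩
  have hbw : Tendsto (fun n => Q (θ n)) atTop (𝓝[QTbar d T] (t, y)) :=
    tendsto_nhdsWithin_iff.2 ⟨hb, Eventually.of_forall hbT⟩
  have huls : ∀ c, u (t, x) < c → ∀ᶠ n in atTop, u (P (θ n)) < c := fun c hc =>
    haw.eventually (hu _ (mem_QTbar.2 hpT) c hc)
  have hwls : ∀ c, w (t, y) < c → ∀ᶠ n in atTop, w (Q (θ n)) < c := fun c hc =>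
    hbw.eventually (hw _ (mem_QTbar.2 hpT) c hc)
  have hpen : Tendsto (fun n => A * ‖(P (θ n)).2 - (Q (θ n)).2‖ ^ 2 + η * (P (θ n)).1) atTop
      (𝓝 (A * ‖x - y‖ ^ 2 + η * t)) :=
    (((ha2.sub hb2).norm.pow 2).const_mul A).add (ha1.const_mul η)
  have hlow : ∀ t' ∈ Icc 0 T, ∀ x' y' : Space d, ∀ n, doubled u w A 0 η (t', x') (t', y') +
      (A * ‖(P (θ n)).2 - (Q (θ n)).2‖ ^ 2 + η * (P (θ n)).1) ≤ u (P (θ n)) + w (Q (θ n)) := by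
    intro t' ht' x' y' n
    have h1 := hPQ (θ n) (t', x') (mem_QTbar.2 ht') (t', y') (mem_QTbar.2 ht')
    simp only [doubled, sub_self] at h1 ⊢
    have : 0 ≤ (θ n : ℝ) * ((P (θ n)).1 - (Q (θ n)).1) ^ 2 := by positivity
    linarith
  have hval : doubled u w A 0 η (t, x) (t, y) + (A * ‖x - y‖ ^ 2 + η * t) =
      u (t, x) + w (t, y) := by
    simp only [doubled]; ring
  have hpen' := hpen.const_add (doubled u w A 0 η (t, x) (t, y))
  rw [hval] at hpen'
  have hulim : Tendsto (fun n => u (P (θ n))) atTop (𝓝 (u (t, x))) :=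
    tendsto_of_eventually_lt_of_le_add huls hwls hpen' (hlow t hpT x y)
  have hwlim : Tendsto (fun n => w (Q (θ n))) atTop (𝓝 (w (t, y))) := by
    refine tendsto_of_eventually_lt_of_le_add hwls huls (by rwa [add_comm (w _)]) fun n => ?_
    rw [add_comm (w _)]
    exact hlow t hpT x y n
  refine ⟨t, hpT, x, y, fun t' ht' x' y' => ?_, fun ht0 => ?_⟩
  · have := le_of_tendsto_of_tendsto' (hpen.const_add _) (hulim.add hwlim) (hlow t' ht' x' y')
    linarith
  · have hΓ : 0 ≤ (Real.Gamma (1 - β))⁻¹ :=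
      inv_nonneg.2 (Real.Gamma_nonneg_of_nonneg (by linarith [hβ.2]))
    have hpow : ∀ {f : ℕ → ℝ}, Tendsto f atTop (𝓝 t) →
        Tendsto (fun n => (f n ^ β)⁻¹ * (Real.Gamma (1 - β))⁻¹) atTop
          (𝓝 ((t ^ β)⁻¹ * (Real.Gamma (1 - β))⁻¹)) := fun hf =>
      ((hf.rpow_const (Or.inl ht0.ne')).inv₀ (Real.rpow_pos_of_pos ht0 _).ne').mul_const _
    have htail : Tendsto (fun n => β * (Real.Gamma (1 - β))⁻¹ *
        (4 * M / min (min (P (θ n)).1 (Q (θ n)).1) 1 ^ 2 * |(P (θ n)).1 - (Q (θ n)).1|)) atTop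
        (𝓝 (β * (Real.Gamma (1 - β))⁻¹ * (4 * M / min (min t t) 1 ^ 2 * |t - t|))) := by
      refine Tendsto.const_mul _ (Tendsto.mul ?_ (ha1.sub hb1).abs)
      refine tendsto_const_nhds.div (((ha1.min hb1).min tendsto_const_nhds).pow 2) ?_
      rw [min_self]
      exact (pow_pos (lt_min ht0 one_pos) 2).ne'
    have hmom : Tendsto (fun n => (2 * A) • ((P (θ n)).2 - (Q (θ n)).2)) atTop
        (𝓝 ((2 * A) • (x - y))) := (ha2.sub hb2).const_smul (2 * A)
    have hH1 := hH.tendsto ha1 ha2 hulim hmom (fun n => (haT n).1) hpT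
    have hH2 := hH.tendsto hb1 hb2 hwlim.neg hmom (fun n => (hbT n).1) hpT
    have hu₀x := (hu₀.tendsto x).comp ha2
    have hu₀y := (hu₀.tendsto y).comp hb2
    have htot := ((((hulim.sub hu₀x).mul (hpow ha1)).add
      ((hwlim.add hu₀y).mul (hpow hb1))).sub htail).add (hH1.sub hH2)
    rw [sub_self, abs_zero, mul_zero, mul_zero, sub_zero] at htot
    refine le_trans (le_of_eq (by ring)) (le_of_tendsto htot ?_)
    filter_upwards [ha1.eventually (lt_mem_nhds ht0), hb1.eventually (lt_mem_nhds ht0)]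
      with n h1 h2
    have h3 := doubled_inequality (t := (P (θ n)).1) (x := (P (θ n)).2) (s := (Q (θ n)).1)
      (y := (Q (θ n)).2) hβ hus hws hu hw huM hwM hη ⟨h1, (haT n).1.2⟩ ⟨h2, (hbT n).1.2⟩
      (hPQ (θ n))
    refine le_trans ?_ h3
    have h4 : 0 ≤ ((P (θ n)).1 ^ β)⁻¹ * (Real.Gamma (1 - β))⁻¹ :=
      mul_nonneg (inv_nonneg.2 (Real.rpow_nonneg h1.le _)) hΓ
    have h5 : 0 ≤ ((Q (θ n)).1 ^ β)⁻¹ * (Real.Gamma (1 - β))⁻¹ :=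
      mul_nonneg (inv_nonneg.2 (Real.rpow_nonneg h2.le _)) hΓ
    have h6 := mul_le_mul_of_nonneg_right (sub_le_sub_left (hui (P (θ n)).2) (u (P (θ n)))) h4
    have h7 : (w (Q (θ n)) + u₀ (Q (θ n)).2) * (((Q (θ n)).1 ^ β)⁻¹ * (Real.Gamma (1 - β))⁻¹) ≤
        (w (Q (θ n)) - w (0, (Q (θ n)).2)) * (((Q (θ n)).1 ^ β)⁻¹ * (Real.Gamma (1 - β))⁻¹) :=
      mul_le_mul_of_nonneg_right (by linarith [hwi (Q (θ n)).2]) h5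
    simp only [Function.comp, Prod.mk.eta]
    linarith

/-- The comparison principle, for a subsolution `u` and a supersolution `-w`. -/
theorem IsWeakSub.comparison (hβ : β ∈ Ioc (0 : ℝ) 1) (hT : 0 < T) (hH : IsHamiltonian T H)
    (hus : IsWeakSub T β H u) (hws : IsWeakSub T β (negHam H) w)
    (hu : UpperSemicontinuousOn u (QTbar d T)) (hw : UpperSemicontinuousOn w (QTbar d T))
    (huM : ∀ p ∈ QTbar d T, |u p| ≤ M) (hwM : ∀ p ∈ QTbar d T, |w p| ≤ M)
    (hup : ∀ t ∈ Icc 0 T, LatticePeriodic fun x => u (t, x))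
    (hwp : ∀ t ∈ Icc 0 T, LatticePeriodic fun x => w (t, x))
    (hu₀ : Continuous u₀) (hper : LatticePeriodic u₀)
    (hui : ∀ x, u (0, x) ≤ u₀ x) (hwi : ∀ x, w (0, x) ≤ -u₀ x) :
    ∀ p ∈ QTbar d T, u p + w p ≤ 0 := by
  by_contra! hcon
  obtain ⟨⟨ts, xs⟩, hps, hpos⟩ := hcon
  rw [mem_QTbar] at hps
  set m := u (ts, xs) + w (ts, xs) with hm
  set η := m / (2 * T) with hηdef
  have hη : 0 < η := by positivity
  have hA : ∀ k : ℕ, (1 : ℝ) ≤ 2 ^ k := fun k => one_le_pow₀ one_le_two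
  choose t ht x y hmax hineq using fun k : ℕ => exists_isMax_doubled_space hβ hT hH hus hws hu hw
    huM hwM hup hwp hu₀ hui hwi hη.le (hA k)
  set Φ : ℕ → ℝ := fun k => doubled u w (2 ^ k) 0 η (t k, x k) (t k, y k) with hΦ
  have hΦlow : ∀ k, m / 2 ≤ Φ k := fun k => by
    have h1 := hmax k ts hps xs xs
    have h2 : doubled u w (2 ^ k) 0 η (ts, xs) (ts, xs) = m - η * ts := by
      simp [doubled, hm]
    have h3 : η * ts ≤ m / 2 := by
      calc η * ts ≤ η * T := mul_le_mul_of_nonneg_left hps.2 hη.le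
        _ = m / 2 := by rw [hηdef]; field_simp
    rw [h2] at h1
    linarith
  have hstep : ∀ k, Φ (k + 1) + 2 ^ k * ‖x (k + 1) - y (k + 1)‖ ^ 2 ≤ Φ k := fun k => by
    have h1 := hmax k (t (k + 1)) (ht _) (x (k + 1)) (y (k + 1))
    simp only [hΦ, doubled, pow_succ] at h1 ⊢
    linarith
  have hanti : Antitone Φ := antitone_nat_of_succ_le fun k => by
    have : 0 ≤ 2 ^ k * ‖x (k + 1) - y (k + 1)‖ ^ 2 := by positivity
    linarith [hstep k]
  have hconv : Tendsto Φ atTop (𝓝 (⨅ k, Φ k)) :=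
    tendsto_atTop_ciInf hanti ⟨m / 2, by rintro _ ⟨k, rfl⟩; exact hΦlow k⟩
  have hq : Tendsto (fun k : ℕ => (2 : ℝ) ^ k * ‖x (k + 1) - y (k + 1)‖ ^ 2) atTop (𝓝 0) := by
    have h1 := hconv.sub (hconv.comp (tendsto_add_atTop_nat 1))
    rw [sub_self] at h1
    refine squeeze_zero (fun k => by positivity) (fun k => ?_) h1
    have := hstep k
    simp only [Function.comp]
    linarith
  have hxy : Tendsto (fun k : ℕ => ‖x (k + 1) - y (k + 1)‖) atTop (𝓝 0) := by
    have h1 : Tendsto (fun k : ℕ => ‖x (k + 1) - y (k + 1)‖ ^ 2) atTop (𝓝 0) := by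
      refine squeeze_zero (fun k => by positivity) (fun k => ?_) hq
      exact le_mul_of_one_le_left (by positivity) (hA k)
    have h2 := h1.sqrt
    simpa only [Real.sqrt_sq (norm_nonneg _), Real.sqrt_zero] using h2
  obtain ⟨ω, hω, hmod⟩ := hH.modulus
  set S := max 1 T with hS
  have hS1 : 1 ≤ S := le_max_left _ _
  have hS0 : 0 < S := by linarith
  have hΓ : 0 ≤ (Real.Gamma (1 - β))⁻¹ :=
    inv_nonneg.2 (Real.Gamma_nonneg_of_nonneg (by linarith [hβ.2]))
  have hg := gcoef_pos hβ.1 hβ.2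
  set e := m / 4 * (S⁻¹ * (Real.Gamma (1 - β))⁻¹) + η * gcoef β * 0 ^ (1 - β) with he
  have he0 : 0 < e := by
    rcases hβ.2.eq_or_lt with h | h
    · have h1 : (0 : ℝ) ^ (1 - β) = 1 := by rw [h, sub_self, Real.rpow_zero]
      rw [he, h1]
      have : 0 ≤ m / 4 * (S⁻¹ * (Real.Gamma (1 - β))⁻¹) := by positivity
      have : 0 < η * gcoef β * 1 := by positivity
      linarith
    · have h1 : 0 < (Real.Gamma (1 - β))⁻¹ :=
        inv_pos.2 (Real.Gamma_pos_of_pos (by linarith))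
      have h2 : 0 ≤ (0 : ℝ) ^ (1 - β) := Real.rpow_nonneg le_rfl _
      positivity
  have harg : Tendsto (fun k : ℕ => ‖x (k + 1) - y (k + 1)‖ *
      (1 + ‖(2 * (2 : ℝ) ^ (k + 1)) • (x (k + 1) - y (k + 1))‖)) atTop (𝓝[≥] 0) := by
    refine tendsto_nhdsWithin_iff.2 ⟨?_, Eventually.of_forall fun k => ?_⟩
    · have h1 := hxy.add (hq.const_mul 4)
      rw [mul_zero, add_zero] at h1
      refine h1.congr fun k => ?_
      rw [norm_smul, Real.norm_of_nonneg (by positivity), pow_succ]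
      ring
    · exact mul_nonneg (norm_nonneg _) (by positivity)
  obtain ⟨δ, hδ, hunif⟩ := uniformContinuous_of_latticePeriodic hu₀ hper
    (show 0 < m / 4 by positivity)
  obtain ⟨k, h1, h2⟩ := (((hω.2.2.2.comp harg).eventually (gt_mem_nhds he0)).and
    (hxy.eventually (gt_mem_nhds hδ))).exists
  set t' := t (k + 1) with ht'
  set x' := x (k + 1) with hx'
  set y' := y (k + 1) with hy'
  have hu0 := abs_lt.1 (hunif x' y' h2)
  have hsum : m / 2 ≤ u (t', x') + w (t', y') := by
    have h3 := hΦlow (k + 1)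
    simp only [hΦ, doubled] at h3
    have h4 : 0 ≤ (2 : ℝ) ^ (k + 1) * ‖x' - y'‖ ^ 2 := by positivity
    have h5 : 0 ≤ η * t' := mul_nonneg hη.le (ht _).1
    linarith
  have htpos : 0 < t' := by
    rcases (ht (k + 1)).1.eq_or_lt with h | h
    · rw [← ht'] at h
      rw [← h] at hsum
      linarith [hui x', hwi y']
    · exact h
  have hi := hineq (k + 1) htpos
  have hH1 : H t' x' (-w (t', y')) ((2 * 2 ^ (k + 1) : ℝ) • (x' - y')) ≤
      H t' x' (u (t', x')) ((2 * 2 ^ (k + 1) : ℝ) • (x' - y')) :=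
    hH.mono t' (ht _) x' _ (by linarith)
  have hH2 := (abs_le.1 (hmod t' (ht _) x' y' (-w (t', y'))
    ((2 * 2 ^ (k + 1) : ℝ) • (x' - y')))).1
  simp only [Function.comp] at h1
  have htS : S⁻¹ ≤ (t' ^ β)⁻¹ := by
    refine inv_anti₀ (Real.rpow_pos_of_pos htpos _) ?_
    calc t' ^ β ≤ S ^ β := Real.rpow_le_rpow htpos.le ((ht _).2.trans (le_max_right _ _)) hβ.1.le
      _ ≤ S ^ (1 : ℝ) := Real.rpow_le_rpow_of_exponent_le hS1 hβ.2
      _ = S := Real.rpow_one S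
  have hquot : m / 4 * (S⁻¹ * (Real.Gamma (1 - β))⁻¹) ≤
      (u (t', x') + w (t', y') - (u₀ x' - u₀ y')) * ((t' ^ β)⁻¹ * (Real.Gamma (1 - β))⁻¹) := by
    refine mul_le_mul (by linarith) (mul_le_mul_of_nonneg_right htS hΓ) (by positivity)
      (by linarith)
  linarith

end Comparison

lemma exists_cutoff {φ : ℝ × Space d → ℝ} (hφ : ContDiffOn ℝ 1 φ (QT d T)) {t₀ : ℝ}
    (ht₀ : 0 < t₀) :
    ∃ φ₁ : ℝ × Space d → ℝ, IsTestFunction T φ₁ ∧ ∀ t, t₀ / 2 ≤ t → ∀ x, φ₁ (t, x) = φ (t, x) := by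
  refine ⟨fun p => Real.smoothTransition (4 / t₀ * p.1 - 1) * φ p, ?_, fun t ht x => ?_⟩
  · refine isTestFunction_of_eq_zero (c := t₀ / 4) ?_ (by positivity) fun t ht x => ?_
    · refine ContDiffOn.mul (ContDiff.contDiffOn ?_) hφ
      exact Real.smoothTransition.contDiff.comp
        ((contDiff_const.mul contDiff_fst).sub contDiff_const)
    · have h : 4 / t₀ * t - 1 ≤ 0 := by
        rw [sub_nonpos, div_mul_eq_mul_div, div_le_one ht₀]; linarith
      simp [Real.smoothTransition.zero_of_nonpos h]
  · have h : 1 ≤ 4 / t₀ * t - 1 := by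
      rw [le_sub_iff_add_le, div_mul_eq_mul_div, le_div_iff₀ ht₀]; linarith
    simp [Real.smoothTransition.one_of_one_le h]

lemma IsSubFamily.isFirstOrderSubsolution_relaxedSup {M : ℝ}
    {H : ℝ → Space d → ℝ → Space d → ℝ} {u₀ : Space d → ℝ} {U : ℝ → ℝ × Space d → ℝ}
    (hF : IsSubFamily T 1 H u₀ U M)
    (hinit : ∀ x, relaxedSup T (𝓝[Ioo (0 : ℝ) 1] 1) U (0, x) = u₀ x) :
    IsFirstOrderSubsolution T H (relaxedSup T (𝓝[Ioo (0 : ℝ) 1] 1) U) := by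
  have hne := neBot_orders hF.order
  have hFI : ∀ᶠ α in 𝓝[Ioo (0 : ℝ) 1] 1, α ∈ Ioo (0 : ℝ) 1 := self_mem_nhdsWithin
  refine ⟨upperSemicontinuousOn_relaxedSup hF.bound, fun t ht =>
    latticePeriodic_relaxedSup hF.bound (hFI.mono fun α h => (hF.sub α h).2.1) ht, ?_⟩
  intro φ t x hφ ht hmax
  obtain ⟨δ₀, hδ₀, hball⟩ := Metric.mem_nhdsWithin_iff.1 hmax
  obtain ⟨φ₁, hφ₁, heq⟩ := exists_cutoff hφ ht.1
  set ψ : ℝ × Space d → ℝ := fun p => 1 * ‖p.2 - x‖ ^ 2 + (1 * (p.1 - t) ^ 2 + 0 * p.1) with hψdef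
  have hψ : ContDiff ℝ 1 ψ := contDiff_spaceTimeQuadratic 1 1 0 t x
  set δ := min (δ₀ / 2) (t / 2) with hδ
  have hδ0 : 0 < δ := lt_min (by linarith) (by linarith [ht.1])
  have hδ1 : δ ≤ δ₀ / 2 := min_le_left _ _
  have hδ2 : δ ≤ t / 2 := min_le_right _ _
  refine le_of_forall_pos_le_add fun ε hε => ?_
  have h := hF.relaxedSup_test hinit (hφ₁.add (isTestFunction_of_contDiff hψ)) (a := t - δ)
    (b := min T (t + δ)) (ρ := δ) (t₀ := t) (x₀ := x)
    ⟨by linarith, by linarith [ht.2]⟩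
    ⟨le_min (ht.1.le.trans ht.2) (by linarith [ht.1]), min_le_left _ _⟩ hδ0
    ⟨by linarith, le_min ht.2 (by linarith)⟩
    (by
      filter_upwards [self_mem_nhdsWithin, mem_nhdsWithin_of_mem_nhds
        (Metric.ball_mem_nhds (t, x) hδ0)] with q h1 h2
      rw [Metric.mem_ball, Prod.dist_eq, max_lt_iff, Real.dist_eq, abs_lt] at h2
      exact ⟨⟨by linarith [h2.1.1], le_min h1.1.2 (by linarith [h2.1.2])⟩,
        Metric.mem_closedBall.2 h2.2.le⟩)
    (by
      rintro ⟨s, y⟩ hq hne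
      have hs := hq.1
      simp only [mem_Icc, le_min_iff] at hs
      have h1 := hball (show (s, y) ∈ Metric.ball (t, x) δ₀ ∩ QT d T from by
        refine ⟨?_, mem_QT.2 ⟨by linarith [ht.1], hs.2.1⟩⟩
        rw [Metric.mem_ball, Prod.dist_eq, max_lt_iff, Real.dist_eq, abs_lt]
        exact ⟨⟨by linarith, by linarith⟩,
          (Metric.mem_closedBall.1 hq.2).trans_lt (by linarith)⟩)
      simp only [mem_ofPred_eq] at h1
      have h2 : 0 < ψ (s, y) := by
        simp only [hψdef, one_mul, zero_mul, add_zero]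
        by_contra! hle
        have h3 := sq_nonneg ‖y - x‖
        have h4 := sq_nonneg (s - t)
        have h5 : ‖y - x‖ ^ 2 = 0 := by linarith
        have h6 : (s - t) ^ 2 = 0 := by linarith
        rw [sq_eq_zero_iff, norm_eq_zero, sub_eq_zero] at h5
        rw [sq_eq_zero_iff, sub_eq_zero] at h6
        exact hne (Prod.ext h6 h5)
      have h7 : ψ (t, x) = 0 := by simp [hψdef]
      rw [h7, heq s (by linarith) y, heq t (by linarith [ht.1]) x]
      linarith) hε
  rw [spaceGrad_add hφ₁.1 hψ.contDiffOn ht, timeDeriv_add hφ₁.1 hψ.contDiffOn ht,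
    spaceGrad_quadratic, timeDeriv_quadratic _ _ _ _ _ ht] at h
  have hgrad : spaceGrad φ₁ t x = spaceGrad φ t x := by
    simp only [spaceGrad]
    congr 1
    funext y
    exact heq t (by linarith [ht.1]) y
  have htime : timeDeriv T φ₁ t x = timeDeriv T φ t x := by
    refine Filter.EventuallyEq.derivWithin_eq ?_ (heq t (by linarith [ht.1]) x)
    filter_upwards [mem_nhdsWithin_of_mem_nhds (Ioi_mem_nhds (show t / 2 < t by linarith [ht.1]))]
      with s hs
    exact heq s (le_of_lt hs) x
  obtain ⟨r, hr⟩ := h.exists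
  rw [K_one, gcoef_one, hgrad, htime] at hr
  simp only [sub_self, smul_zero, add_zero, mul_zero, Real.rpow_zero, mul_one, zero_add] at hr
  linarith

lemma IsSubFamily.relaxedSup_initial (hT : 0 < T) {β M : ℝ} {H : ℝ → Space d → ℝ → Space d → ℝ}
    {u₀ : Space d → ℝ} {U : ℝ → ℝ × Space d → ℝ} (hF : IsSubFamily T β H u₀ U M)
    (hper : LatticePeriodic u₀) (x : Space d) :
    relaxedSup T (𝓝[Ioo (0 : ℝ) 1] β) U (0, x) = u₀ x := by
  have hne := neBot_orders hF.order
  have hFI : ∀ᶠ α in 𝓝[Ioo (0 : ℝ) 1] β, α ∈ Ioo (0 : ℝ) 1 := self_mem_nhdsWithin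
  have h0 : ((0 : ℝ), x) ∈ QTbar d T := mem_QTbar.2 (left_mem_Icc.2 hT.le)
  refine le_antisymm (le_of_forall_pos_le_add fun ε hε => ?_)
    (le_relaxedSup hF.bound h0 (hFI.mono fun α h => (hF.init α h x).ge))
  have hγ : 0 < β / 2 := half_pos hF.order.1
  have hFγ : ∀ᶠ α in 𝓝[Ioo (0 : ℝ) 1] β, β / 2 < α :=
    mem_nhdsWithin_of_mem_nhds (Ioi_mem_nhds (by linarith))
  obtain ⟨k, C, h⟩ := exists_uniform_initial hT hF.ham hF.cont hper hγ x (half_pos hε)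
  have hcont : Continuous fun p : ℝ × Space d =>
      u₀ x + ε / 2 + k * ‖p.2 - x‖ ^ 2 + C * p.1 ^ (β / 2) :=
    ((continuous_const).add (by fun_prop)).add
      (continuous_const.mul ((Real.continuous_rpow_const hγ.le).comp continuous_fst))
  have hval : u₀ x + ε / 2 + k * ‖x - x‖ ^ 2 + C * (0 : ℝ) ^ (β / 2) < u₀ x + ε := by
    simp [Real.zero_rpow hγ.ne', hε]
  have hlt := (hcont.tendsto (0, x)).eventually (gt_mem_nhds hval)
  refine relaxedSup_le hF.bound h0 ?_
  filter_upwards [(hFI.and hFγ).prod_mk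
    ((hlt.filter_mono nhdsWithin_le_nhds).and self_mem_nhdsWithin)] with q hq
  exact (h q.1 (U q.1) hq.1.2.le hq.1.1.2 (hF.sub _ hq.1.1) (hF.init _ hq.1.1) q.2.1 hq.2.2.1
    q.2.2).trans hq.2.1.le

lemma relaxedSup_add_relaxedSup_neg_nonneg {F : Filter ℝ} [F.NeBot] {U : ℝ → ℝ × Space d → ℝ}
    {M : ℝ} (hM : ∀ᶠ α in F, ∀ p ∈ QTbar d T, |U α p| ≤ M) {p : ℝ × Space d}
    (hp : p ∈ QTbar d T) :
    0 ≤ relaxedSup T F U p + relaxedSup T F (fun α q => -U α q) p := by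
  have hM' : ∀ᶠ α in F, ∀ p ∈ QTbar d T, |(fun α q => -U α q) α p| ≤ M :=
    hM.mono fun α h p hp => by rw [abs_neg]; exact h p hp
  have : (𝓝[QTbar d T] p).NeBot := mem_closure_iff_nhdsWithin_neBot.1 (subset_closure hp)
  by_contra! hlt
  obtain ⟨c, h1, h2⟩ := exists_between (show relaxedSup T F U p <
    -relaxedSup T F (fun α q => -U α q) p by linarith)
  obtain ⟨q, h3, h4⟩ := ((eventually_lt_of_relaxedSup_lt hM h1).and
    (eventually_lt_of_relaxedSup_lt hM' (lt_neg_of_lt_neg h2))).exists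
  linarith

lemma relaxedSup_of_notMem {F : Filter ℝ} {U : ℝ → ℝ × Space d → ℝ} {p : ℝ × Space d}
    (hp : p ∉ QTbar d T) : relaxedSup T F U p = 0 := by
  have hcl : IsClosed (QTbar d T) := isClosed_Icc.prod isClosed_univ
  have : 𝓝[QTbar d T] p = ⊥ := by
    rwa [← not_neBot, ← mem_closure_iff_nhdsWithin_neBot, hcl.closure_eq]
  simp [relaxedSup, this, limsup, limsSup]

section Solutions

variable {β : ℝ} {H : ℝ → Space d → ℝ → Space d → ℝ} {u₀ : Space d → ℝ} {u : ℝ × Space d → ℝ}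

lemma IsSolution.isWeakSub (hβ : β ∈ Ioc (0 : ℝ) 1) (h : IsSolution T β H u₀ u) :
    IsWeakSub T β H u := by
  rcases hβ.2.eq_or_lt with rfl | hlt
  · exact (h.2.1.2 rfl).isWeakSub
  · exact (h.2.1.1 hlt.ne).isWeakSub ⟨hβ.1, hlt⟩

lemma IsSolution.isWeakSub_neg (hβ : β ∈ Ioc (0 : ℝ) 1) (h : IsSolution T β H u₀ u) :
    IsWeakSub T β (negHam H) fun p => -u p := by
  rcases hβ.2.eq_or_lt with rfl | hlt
  · exact (h.2.2.1.2 rfl).neg.isWeakSub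
  · exact (h.2.2.1.1 hlt.ne).neg.isWeakSub ⟨hβ.1, hlt⟩

lemma IsSolution.periodic (h : IsSolution T β H u₀ u) :
    ∀ t ∈ Icc 0 T, LatticePeriodic fun x => u (t, x) := by
  by_cases hβ : β = 1
  · exact (h.2.1.2 hβ).2.1
  · exact (h.2.1.1 hβ).2.1

lemma IsSolution.exists_bound (h : IsSolution T β H u₀ u) :
    ∃ M, ∀ p ∈ QTbar d T, |u p| ≤ M := by
  obtain ⟨R₀, hR₀, hlat⟩ := exists_lattice_near d
  obtain ⟨M, hM⟩ := (isCompact_Icc.prod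
    (isCompact_closedBall (0 : Space d) R₀)).exists_bound_of_continuousOn
    (h.1.mono fun p hp => ⟨hp.1, mem_univ _⟩)
  refine ⟨M, ?_⟩
  rintro ⟨t, x⟩ hp
  obtain ⟨z, hz⟩ := hlat x 0
  have h1 := hM (t, x + latticeVec z) ⟨hp.1, mem_closedBall_iff_norm.2 hz⟩
  have h2 : u (t, x + latticeVec z) = u (t, x) := h.periodic t hp.1 x z
  rwa [h2] at h1

end Solutions

section Convergence

variable {β : ℝ} {H : ℝ → Space d → ℝ → Space d → ℝ} {u₀ : Space d → ℝ}
  {u : ℝ → ℝ × Space d → ℝ}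

lemma exists_isSubFamily (hT : 0 < T) (hβ : β ∈ Ioc (0 : ℝ) 1) (hH : IsHamiltonian T H)
    (hper : LatticePeriodic u₀) (hu₀ : Continuous u₀)
    (hu : ∀ α ∈ Ioo (0 : ℝ) 1, IsSolution T α H u₀ (u α)) :
    ∃ M, IsSubFamily T β H u₀ u M ∧
      IsSubFamily T β (negHam H) (fun x => -u₀ x) (fun α p => -u α p) M := by
  have hγ : 0 < β / 2 := half_pos hβ.1
  have hsub : ∀ α ∈ Ioo (0 : ℝ) 1, IsFracSubsolution T α H (u α) := fun α hα =>
    (hu α hα).2.1.1 hα.2.ne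
  have hsup : ∀ α ∈ Ioo (0 : ℝ) 1, IsFracSubsolution T α (negHam H) fun p => -u α p :=
    fun α hα => ((hu α hα).2.2.1.1 hα.2.ne).neg
  obtain ⟨M₁, h1⟩ := exists_uniform_bound hT hH hu₀ hper hγ
  obtain ⟨M₂, h2⟩ := exists_uniform_bound hT hH.neg hu₀.neg hper.neg hγ
  have hFI : ∀ᶠ α in 𝓝[Ioo (0 : ℝ) 1] β, α ∈ Ioo (0 : ℝ) 1 := self_mem_nhdsWithin
  have hFγ : ∀ᶠ α in 𝓝[Ioo (0 : ℝ) 1] β, β / 2 < α :=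
    mem_nhdsWithin_of_mem_nhds (Ioi_mem_nhds (by linarith [hβ.1]))
  have hb : ∀ᶠ α in 𝓝[Ioo (0 : ℝ) 1] β, ∀ p ∈ QTbar d T, |u α p| ≤ max M₁ M₂ := by
    filter_upwards [hFI, hFγ] with α hα hαγ
    rintro ⟨t, x⟩ hp
    have e1 := h1 α (u α) hαγ.le hα.2 (hsub α hα) (hu α hα).2.2.2 t hp.1 x
    have e2 := h2 α (fun p => -u α p) hαγ.le hα.2 (hsup α hα)
      (fun x => congrArg Neg.neg ((hu α hα).2.2.2 x)) t hp.1 x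
    exact abs_le.2 ⟨by linarith [le_max_right M₁ M₂], e1.trans (le_max_left _ _)⟩
  exact ⟨max M₁ M₂, ⟨hβ, hH, hsub, fun α hα => (hu α hα).2.2.2, hu₀, hb⟩,
    ⟨hβ, hH.neg, hsup, fun α hα x => by rw [(hu α hα).2.2.2], hu₀.neg,
      hb.mono fun α h p hp => by rw [abs_neg]; exact h p hp⟩⟩

lemma IsSubFamily.periodic_relaxedSup {M : ℝ} (hF : IsSubFamily T β H u₀ u M) :
    ∀ t ∈ Icc 0 T, LatticePeriodic fun x => relaxedSup T (𝓝[Ioo (0 : ℝ) 1] β) u (t, x) := by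
  have hne := neBot_orders hF.order
  have hFI : ∀ᶠ α in 𝓝[Ioo (0 : ℝ) 1] β, α ∈ Ioo (0 : ℝ) 1 := self_mem_nhdsWithin
  exact fun t ht => latticePeriodic_relaxedSup hF.bound
    (hFI.mono fun α h => (hF.sub α h).2.1) ht

/-- Subsolutions of orders `α → β` asymptotically lie below every solution of order `β`. -/
lemma IsSubFamily.relaxedSup_add_le {M : ℝ} (hT : 0 < T) (hF : IsSubFamily T β H u₀ u M)
    (hper : LatticePeriodic u₀) {w : ℝ × Space d → ℝ} {M' : ℝ} (hw : IsWeakSub T β (negHam H) w)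
    (hwc : UpperSemicontinuousOn w (QTbar d T)) (hwM : ∀ p ∈ QTbar d T, |w p| ≤ M')
    (hwp : ∀ t ∈ Icc 0 T, LatticePeriodic fun x => w (t, x)) (hwi : ∀ x, w (0, x) ≤ -u₀ x) :
    ∀ p ∈ QTbar d T, relaxedSup T (𝓝[Ioo (0 : ℝ) 1] β) u p + w p ≤ 0 := by
  have hne := neBot_orders hF.order
  have hinit := hF.relaxedSup_initial hT hper
  exact (hF.isWeakSub_relaxedSup hinit).comparison (M := max M M') (u₀ := u₀) hF.order hT hF.ham hw
    (upperSemicontinuousOn_relaxedSup hF.bound) hwc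
    (fun p hp => (abs_relaxedSup_le hF.bound hp).trans (le_max_left _ _))
    (fun p hp => (hwM p hp).trans (le_max_right _ _)) hF.periodic_relaxedSup hwp hF.cont hper
    (fun x => (hinit x).le) hwi

/-- Convergence of the solutions to a solution of the limit problem. -/
theorem tendstoLocallyUniformlyOn_of_isSolution (hT : 0 < T) (hβ : β ∈ Ioc (0 : ℝ) 1)
    (hH : IsHamiltonian T H) (hper : LatticePeriodic u₀) (hu₀ : Continuous u₀)
    (hu : ∀ α ∈ Ioo (0 : ℝ) 1, IsSolution T α H u₀ (u α)) {v : ℝ × Space d → ℝ}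
    (hv : IsSolution T β H u₀ v) :
    TendstoLocallyUniformlyOn u v (𝓝[Ioo (0 : ℝ) 1] β) (QT d T) := by
  have hne := neBot_orders hβ
  obtain ⟨M, hF, hF'⟩ := exists_isSubFamily hT hβ hH hper hu₀ hu
  obtain ⟨M', hM'⟩ := hv.exists_bound
  have hupper := hF.relaxedSup_add_le hT hper (hv.isWeakSub_neg hβ)
    hv.1.neg.upperSemicontinuousOn (fun p hp => by rw [abs_neg]; exact hM' p hp)
    (fun t ht => (hv.periodic t ht).neg) (fun x => by rw [hv.2.2.2])
  have hlower := hF'.relaxedSup_add_le (w := v) hT hper.neg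
    (by rw [negHam_negHam]; exact hv.isWeakSub hβ) hv.1.upperSemicontinuousOn hM' hv.periodic
    (fun x => by rw [hv.2.2.2, neg_neg])
  rw [tendstoLocallyUniformlyOn_iff_filter]
  intro p hp
  have hpb := QT_subset_QTbar hp
  rw [Metric.tendstoUniformlyOnFilter_iff]
  intro ε hε
  have h1 := eventually_lt_of_relaxedSup_lt hF.bound (p := p) (c := v p + ε / 2)
    (by linarith [hupper p hpb])
  have h2 := eventually_lt_of_relaxedSup_lt hF'.bound (p := p) (c := -v p + ε / 2)
    (by linarith [hlower p hpb])
  have h3 : ∀ᶠ q in 𝓝[QTbar d T] p, dist (v q) (v p) < ε / 2 :=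
    (hv.1 p hpb).eventually (Metric.ball_mem_nhds _ (half_pos hε))
  have h4 := (h1.and h2).and (h3.prod_inr (𝓝[Ioo (0 : ℝ) 1] β))
  refine (h4.filter_mono (prod_mono le_rfl (nhdsWithin_mono p QT_subset_QTbar))).mono ?_
  rintro q ⟨⟨e1, e2⟩, e3⟩
  rw [Real.dist_eq, abs_lt] at e3 ⊢
  constructor <;> linarith

/-- The relaxed limit of the solutions of orders `α → 1` solves the first-order problem. -/
theorem exists_isSolution_one (hT : 0 < T) (hH : IsHamiltonian T H) (hper : LatticePeriodic u₀)
    (hu₀ : Continuous u₀) (hu : ∀ α ∈ Ioo (0 : ℝ) 1, IsSolution T α H u₀ (u α)) :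
    ∃ v, IsSolution T 1 H u₀ v := by
  have h1 : (1 : ℝ) ∈ Ioc (0 : ℝ) 1 := ⟨one_pos, le_rfl⟩
  have hne := neBot_orders h1
  obtain ⟨M, hF, hF'⟩ := exists_isSubFamily hT h1 hH hper hu₀ hu
  set v := relaxedSup T (𝓝[Ioo (0 : ℝ) 1] 1) u with hv
  have hinit := hF.relaxedSup_initial hT hper
  have hinit' := hF'.relaxedSup_initial hT hper.neg
  have hle := hF.relaxedSup_add_le hT hper (hF'.isWeakSub_relaxedSup hinit')
    (upperSemicontinuousOn_relaxedSup hF'.bound) (fun p hp => abs_relaxedSup_le hF'.bound hp)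
    hF'.periodic_relaxedSup (fun x => (hinit' x).le)
  have heq : v = fun p => -relaxedSup T (𝓝[Ioo (0 : ℝ) 1] 1) (fun α p => -u α p) p := by
    funext p
    by_cases hp : p ∈ QTbar d T
    · have := relaxedSup_add_relaxedSup_neg_nonneg hF.bound hp
      have := hle p hp
      simp only [hv]
      linarith
    · rw [hv, relaxedSup_of_notMem hp, relaxedSup_of_notMem hp, neg_zero]
  have hsub : IsFirstOrderSubsolution T H v := hF.isFirstOrderSubsolution_relaxedSup hinit
  have hsup : IsFirstOrderSupersolution T H v := by
    have := (hF'.isFirstOrderSubsolution_relaxedSup hinit').neg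
    rwa [negHam_negHam, ← heq] at this
  exact ⟨v, continuousOn_iff_lower_upperSemicontinuousOn.2 ⟨hsup.1, hsub.1⟩,
    ⟨fun h => absurd rfl h, fun _ => hsub⟩, ⟨fun h => absurd rfl h, fun _ => hsup⟩, hinit⟩

end Convergence

end FracHJ

theorem mainTheorem6 (d : ℕ) (T : ℝ) (hT : 0 < T)
    (H : ℝ → FracHJ.Space d → ℝ → FracHJ.Space d → ℝ) (u₀ : FracHJ.Space d → ℝ)
    -- the Hamiltonian is a function on `[0,T] × 𝕋^d × ℝ × ℝ^d`
    (hHper : ∀ t ∈ Icc 0 T, ∀ (r : ℝ) (p : FracHJ.Space d),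
      FracHJ.LatticePeriodic fun x => H t x r p)
    -- (A1)
    (hA1 : ContinuousOn
      (fun q : ℝ × FracHJ.Space d × ℝ × FracHJ.Space d => H q.1 q.2.1 q.2.2.1 q.2.2.2)
      (Icc 0 T ×ˢ univ))
    -- (A2)
    (hA2 : ∃ ω : ℝ → ℝ, FracHJ.IsModulus ω ∧
      ∀ t ∈ Icc 0 T, ∀ (x y : FracHJ.Space d) (r : ℝ) (p : FracHJ.Space d),
        |H t x r p - H t y r p| ≤ ω (‖x - y‖ * (1 + ‖p‖)))
    -- (A3)
    (hA3 : ∀ t ∈ Icc 0 T, ∀ (x p : FracHJ.Space d), Monotone fun r => H t x r p)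
    -- (A4)
    (hu₀per : FracHJ.LatticePeriodic u₀) (hA4 : Continuous u₀)
    -- for every order `α ∈ (0,1)`, the function `u α` is a viscosity solution
    (u : ℝ → ℝ × FracHJ.Space d → ℝ)
    (hu : ∀ α ∈ Ioo (0 : ℝ) 1, FracHJ.IsSolution T α H u₀ (u α))
    (β : ℝ) (hβ : β ∈ Ioc (0 : ℝ) 1) :
    (∃ uβ : ℝ × FracHJ.Space d → ℝ, FracHJ.IsSolution T β H u₀ uβ) ∧
    ∀ uβ : ℝ × FracHJ.Space d → ℝ, FracHJ.IsSolution T β H u₀ uβ →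
      TendstoLocallyUniformlyOn u uβ (𝓝[Ioo (0 : ℝ) 1] β) (FracHJ.QT d T) := by
  have hH : FracHJ.IsHamiltonian T H := ⟨hHper, hA1, hA2, hA3⟩
  refine ⟨?_, fun uβ huβ =>
    FracHJ.tendstoLocallyUniformlyOn_of_isSolution hT hβ hH hu₀per hA4 hu huβ⟩
  rcases hβ.2.eq_or_lt with rfl | hlt
  · exact FracHJ.exists_isSolution_one hT hH hu₀per hA4 hu
  · exact ⟨u β, hu β ⟨hβ.1, hlt⟩⟩
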